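/- Let $n,g,\ell$ be non-negative integers. There is an integer $k_0=k_0(n,g,\ell)$ such that the following holds for all integers $\delta_0$ with $-[(\ell n-1)/2]\le\delta_0\le[(\ell n-1)/2]$ (so that $n,\ell\ge 1$) and all integers $k\ge k_0$. Put $$\gamma=\frac{2n}{\ell n-2\delta_0},\qquad \mu=2+\frac{\delta_0}{n}-\gamma\ell,\qquad \eta=\frac{\gamma}{k-g+\mu}.$$ Then $\eta$ is a positive rational number. Let $X$ be a smooth connected projective complex curve of genus $g$ with distinct marked points $p_1,\dots,p_\ell$, and let $E$ be a vector bundle on $X$ of rank $n$ and degree $\delta_0$. For each $i$ let $g_i\subset E_{p_i}\oplus\mathbb C^n$ be an $n$-dimensional subspace, write $\vec g=(g_1,\dots,g_\ell)$, and let $$s_i=\dim(g_i\cap E_{p_i}),\qquad t_i=\dim(g_i\cap\mathbb C^n).$$ Let $N$ be a line bundle of degree $k$ on $X$, let $E(k)=E\otimes N$, and identify $E(k)_{p_i}\cong E_{p_i}$ by choosing nonzero vectors of $N_{p_i}$. Let $V=H^0(X,E(k))$, and suppose that $E(k)$ is generated by its global sections and that $\dim V=p:=\delta_0+kn+n(1-g)$.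 Let $\alpha:\Lambda^nV\to H^0(X,\det E(k))$ be the determinant map. Let $\beta_i\in\mathbb P(\Lambda^n(V\oplus\mathbb C^n)^*)$ be the Plücker point of the annihilator of the preimage of $g_i$ under $V\oplus\mathbb C^n\to E(k)_{p_i}\oplus\mathbb C^n\cong E_{p_i}\oplus\mathbb C^n$. Let $\mathbb C^*$ act through weight $-n$ on $V^*$ and weight $p$ on $(\mathbb C^n)^*$. Call $(E,\vec g)$ $k$-$\mathbb C^*$-(semi)stable if the point $(\alpha,\beta_1,\dots,\beta_\ell)$ of $$\mathbb P(\mathrm{Hom}(\Lambda^nV,H^0(X,\det E(k))))\times\mathbb P(\Lambda^n(V\oplus\mathbb C^n)^*)^{\ell}$$ is GIT (semi)stable for this action with respect to the induced linearization of $\mathcal O(a)\boxtimes\mathcal O(b)\boxtimes\cdots\boxtimes\mathcal O(b)$, where $a,b$ are positive integers with $b/a=\eta$. Here semistable means that some invariant section of a positive power of this line bundle does not vanish at the point. Stable means that, in addition, the orbit is closed in the semistable locus and the stabilizer is finite. Then, for every choice of such $a,b$, $(E,\vec g)$ is $k$-$\mathbb C^*$-semistable if and only if $$\sum_{i=1}^{\ell}s_i\le\frac{\ell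 n}{2}-\delta_0\quad\text{and}\quad\sum_{i=1}^{\ell}t_i\le\frac{\ell n}{2}+\delta_0,$$ and $(E,\vec g)$ is $k$-$\mathbb C^*$-stable if and only if both inequalities are strict. -/

import Mathlib

open scoped Manifold ContDiff Bundle
open Bundle

noncomputable section

/-! ### Holomorphic vector bundles on a Riemann surface

A smooth projective curve over `ℂ` is a compact connected Riemann surface `X`; a holomorphic
vector bundle on it is a Mathlib vector bundle `E` with model fibre `F` which is `C^ω` over `ℂ`. -/

section Bundles

variable {X : Type*} [TopologicalSpace X] [ChartedSpace ℂ X]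
variable (F : Type*) [NormedAddCommGroup F] [NormedSpace ℂ F]
variable (E : X → Type*) [∀ x, AddCommGroup (E x)] [∀ x, Module ℂ (E x)]
  [TopologicalSpace (TotalSpace F E)] [∀ x, TopologicalSpace (E x)]
  [FiberBundle F E] [VectorBundle ℂ F E]

/-- `H⁰(X, E)`: the global holomorphic sections. -/
abbrev HolSections [ContMDiffVectorBundle ω F E 𝓘(ℂ, ℂ)] : Type _ :=
  Cₛ^ω⟮𝓘(ℂ, ℂ); F, E⟯

/-- The value of a set-theoretic section at `x`, in the preferred trivialization around `x₀`. -/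
def localRep (x₀ : X) (s : ∀ x, E x) (x : X) : F :=
  (trivializationAt F E x₀).linearMapAt ℂ x (s x)

/-- A section (with arbitrary values at its poles) is meromorphic at `x₀`. -/
def IsMeromorphicSectionAt (s : ∀ x, E x) (x₀ : X) : Prop :=
  MeromorphicAt (fun z : ℂ => localRep F E x₀ s ((chartAt ℂ x₀).symm z)) (chartAt ℂ x₀ x₀)

/-- The order at `x₀` of `s₁ ∧ ⋯ ∧ s_r`, a meromorphic section of `det E` (`r` the rank):
positive at zeros, negative at poles, `⊤` if it vanishes identically near `x₀`. -/
def wedgeOrderAt (s : Fin (Module.finrank ℂ F) → ∀ x, E x) [FiniteDimensional ℂ F] (x₀ : X) :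
    WithTop ℤ :=
  meromorphicOrderAt
    (fun z : ℂ => (Module.finBasis ℂ F).det
      (fun j => localRep F E x₀ (s j) ((chartAt ℂ x₀).symm z)))
    (chartAt ℂ x₀ x₀)

/-- `E` has degree `d`: the divisor of a nonzero meromorphic section
`s₁ ∧ ⋯ ∧ s_r` of `det E` has degree `d`. -/
def HasDegree [FiniteDimensional ℂ F] (d : ℤ) : Prop :=
  ∃ s : Fin (Module.finrank ℂ F) → ∀ x, E x,
    (∀ j x₀, IsMeromorphicSectionAt F E (s j) x₀) ∧
    (∀ x₀, wedgeOrderAt F E s x₀ ≠ ⊤) ∧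
    ∑ᶠ x₀, (wedgeOrderAt F E s x₀).untop₀ = d

/-- `H⁰(X, ⋀ⁿ E)`: families `σ x ∈ ⋀ⁿ (E x)` all of whose coordinates in the local
trivializations of `⋀ⁿ E` are holomorphic. For `n` the rank of `E` this is `H⁰(X, det E)`. -/
def wedgeSections (n : ℕ) : Submodule ℂ (∀ x, ⋀[ℂ]^n (E x)) where
  carrier := {σ | ∀ (x₀ : X) (φ : ⋀[ℂ]^n F →ₗ[ℂ] ℂ),
    ContMDiffAt 𝓘(ℂ, ℂ) 𝓘(ℂ, ℂ) ω
      (fun x => φ (exteriorPower.map n ((trivializationAt F E x₀).linearMapAt ℂ x) (σ x))) x₀}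
  add_mem' := by
    intro a b ha hb x₀ φ
    have h := (ha x₀ φ).add (hb x₀ φ)
    refine h.congr_of_eventuallyEq (Filter.Eventually.of_forall fun x => ?_)
    simp
  zero_mem' := by
    intro x₀ φ
    simpa using contMDiffAt_const
  smul_mem' := by
    intro c a ha x₀ φ
    have h := (contMDiffAt_const (I := 𝓘(ℂ, ℂ)) (I' := 𝓘(ℂ, ℂ)) (n := ω) (c := c)).smul (ha x₀ φ)
    refine h.congr_of_eventuallyEq (Filter.Eventually.of_forall fun x => ?_)
    simp

/-- `wedgeSections` as a vector space in its own right. -/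
def WedgeSections (n : ℕ) : Type _ := ↥(wedgeSections F E n)

instance (n : ℕ) : AddCommGroup (WedgeSections F E n) :=
  inferInstanceAs (AddCommGroup ↥(wedgeSections F E n))

instance (n : ℕ) : Module ℂ (WedgeSections F E n) :=
  inferInstanceAs (Module ℂ ↥(wedgeSections F E n))

/-- Evaluation of holomorphic sections at a point. -/
def evalAt [ContMDiffVectorBundle ω F E 𝓘(ℂ, ℂ)] (x : X) : HolSections F E →ₗ[ℂ] E x where
  toFun s := s x
  map_add' _ _ := rfl
  map_smul' _ _ := rfl

variable {F E}

/-- A multilinear function of holomorphic functions is holomorphic. -/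
theorem contMDiffAt_multilinear [FiniteDimensional ℂ F] {n : ℕ}
    (A : MultilinearMap ℂ (fun _ : Fin n => F) ℂ) {f : Fin n → X → F} {x₀ : X}
    (hf : ∀ j, ContMDiffAt 𝓘(ℂ, ℂ) 𝓘(ℂ, F) ω (f j) x₀) :
    ContMDiffAt 𝓘(ℂ, ℂ) 𝓘(ℂ, ℂ) ω (fun x => A (fun j => f j x)) x₀ := by
  classical
  let b := Module.finBasis ℂ F
  have key : ∀ x, A (fun j => f j x) =
      ∑ r : Fin n → Fin (Module.finrank ℂ F),
        (∏ j, b.coord (r j) (f j x)) * A (fun j => b (r j)) := by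
    intro x
    have h1 : (fun j => f j x) = fun j => ∑ i, b.coord i (f j x) • b i := by
      funext j
      exact (b.sum_repr (f j x)).symm
    rw [h1, MultilinearMap.map_sum]
    refine Finset.sum_congr rfl fun r _ => ?_
    rw [MultilinearMap.map_smul_univ, smul_eq_mul]
  simp_rw [key]
  refine contMDiffAt_finsetSum fun r _ => ContMDiffAt.mul ?_ contMDiffAt_const
  refine contMDiffAt_finsetProd fun j _ => ?_
  exact ((LinearMap.toContinuousLinearMap (b.coord (r j))).contMDiff.contMDiffAt).comp x₀ (hf j)

/-- The wedge of holomorphic sections is a holomorphic section. -/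
theorem wedge_mem_wedgeSections [FiniteDimensional ℂ F] [ContMDiffVectorBundle ω F E 𝓘(ℂ, ℂ)]
    (n : ℕ) (w : ⋀[ℂ]^n (HolSections F E)) :
    (fun x => exteriorPower.map n (evalAt F E x) w) ∈ wedgeSections F E n := by
  have hw : w ∈ Submodule.span ℂ (Set.range (exteriorPower.ιMulti ℂ n (M := HolSections F E))) := by
    rw [exteriorPower.ιMulti_span]; trivial
  induction hw using Submodule.span_induction with
  | mem w h =>
    obtain ⟨v, rfl⟩ := h
    intro x₀ φ
    have h := contMDiffAt_multilinear
      (φ.compAlternatingMap (exteriorPower.ιMulti ℂ n)).toMultilinearMap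
      (f := fun j x => localRep F E x₀ (v j) x) (x₀ := x₀) ?_
    · refine h.congr_of_eventuallyEq (Filter.Eventually.of_forall fun x => ?_)
      simp only [exteriorPower.map_apply_ιMulti]
      rfl
    · intro j
      have h2 := (contMDiffAt_section x₀).1 ((v j).contMDiff x₀)
      refine h2.congr_of_eventuallyEq ?_
      filter_upwards [(trivializationAt F E x₀).open_baseSet.mem_nhds
        (mem_baseSet_trivializationAt F E x₀)] with x hx
      simp [localRep, Trivialization.linearMapAt_apply, hx]
  | zero =>
    have : (fun x => exteriorPower.map n (evalAt F E x) (0 : ⋀[ℂ]^n (HolSections F E))) = 0 := by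
      funext x; simp
    rw [this]; exact Submodule.zero_mem _
  | add a b _ _ ha hb =>
    have : (fun x => exteriorPower.map n (evalAt F E x) (a + b)) =
        (fun x => exteriorPower.map n (evalAt F E x) a) +
          (fun x => exteriorPower.map n (evalAt F E x) b) := by
      funext x; simp
    rw [this]; exact Submodule.add_mem _ ha hb
  | smul c a _ ha =>
    have : (fun x => exteriorPower.map n (evalAt F E x) (c • a)) =
        c • (fun x => exteriorPower.map n (evalAt F E x) a) := by
      funext x; simp
    rw [this]; exact Submodule.smul_mem _ c ha

variable (F E)

/-- The determinant map on sections `⋀ⁿ H⁰(X, E) → H⁰(X, ⋀ⁿ E)`,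
`(v₁ ∧ ⋯ ∧ vₙ)(x) = v₁(x) ∧ ⋯ ∧ vₙ(x)`. -/
def detMap [FiniteDimensional ℂ F] [ContMDiffVectorBundle ω F E 𝓘(ℂ, ℂ)] (n : ℕ) :
    ⋀[ℂ]^n (HolSections F E) →ₗ[ℂ] WedgeSections F E n :=
  (LinearMap.pi (fun x => exteriorPower.map n (evalAt F E x))).codRestrict _
    (wedge_mem_wedgeSections n)

end Bundles

/-- The genus: the dimension of the space of holomorphic `1`-forms. -/
def genus (X : Type*) [TopologicalSpace X] [ChartedSpace ℂ X] [IsManifold 𝓘(ℂ, ℂ) ω X] : ℕ :=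
  Module.finrank ℂ (Cₛ^ω⟮𝓘(ℂ, ℂ); ℂ →L[ℂ] ℂ,
    fun x : X => TangentSpace 𝓘(ℂ, ℂ) x →L[ℂ] Bundle.Trivial X ℂ x⟯)

/-- The dual bundle. -/
abbrev DualBundle {X : Type*} (N : X → Type*) [∀ x, AddCommGroup (N x)] [∀ x, Module ℂ (N x)]
    [∀ x, TopologicalSpace (N x)] (x : X) : Type _ :=
  N x →L[ℂ] Bundle.Trivial X ℂ x

/-- `E ⊗ N` for a line bundle `N`, realised as `Hom(N^∨, E)`. -/
abbrev Twist {X : Type*} (E N : X → Type*) [∀ x, AddCommGroup (E x)] [∀ x, Module ℂ (E x)]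
    [∀ x, TopologicalSpace (E x)] [∀ x, AddCommGroup (N x)] [∀ x, Module ℂ (N x)]
    [∀ x, TopologicalSpace (N x)] (x : X) : Type _ :=
  DualBundle N x →L[ℂ] E x

/-- The identification `E_x ≅ (E ⊗ N)_x` given by a nonzero vector `u ∈ N_x`, namely `e ↦ e ⊗ u`. -/
def twistFibre {X : Type*} (E N : X → Type*) [∀ x, AddCommGroup (E x)] [∀ x, Module ℂ (E x)]
    [∀ x, TopologicalSpace (E x)] [∀ x, IsTopologicalAddGroup (E x)]
    [∀ x, ContinuousSMul ℂ (E x)]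
    [∀ x, AddCommGroup (N x)] [∀ x, Module ℂ (N x)] [∀ x, TopologicalSpace (N x)]
    [∀ x, IsTopologicalAddGroup (N x)] [∀ x, ContinuousSMul ℂ (N x)]
    (x : X) (u : N x) : E x →ₗ[ℂ] Twist E N x :=
  let ev : DualBundle N x →L[ℂ] ℂ :=
    { toFun := fun φ => φ u
      map_add' := fun _ _ => rfl
      map_smul' := fun _ _ => rfl
      cont := continuous_eval_const u }
  { toFun := fun e => ev.smulRight e
    map_add' := by intro a b; ext φ; simp
    map_smul' := by intro c a; ext φ; exact smul_comm _ _ _ }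

/-! ### GIT stability in `ℙ(A) × ℙ(B)^ℓ`

`G` acts linearly on `A` and `B`; points of `ℙ(A) × ℙ(B)^ℓ` are represented by nonzero vectors. -/

namespace GIT

variable {A B : Type*} [AddCommGroup A] [Module ℂ A] [AddCommGroup B] [Module ℂ B] {ℓ : ℕ}

/-- Forms of multidegree `(a, b₁, …, b_ℓ)` on `A × B^ℓ`, i.e. sections of
`𝒪(a) ⊠ 𝒪(b₁) ⊠ ⋯ ⊠ 𝒪(b_ℓ)`, given by multilinear maps with repeated arguments. -/
abbrev Form (A B : Type*) [AddCommGroup A] [Module ℂ A] [AddCommGroup B] [Module ℂ B]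
    (ℓ a : ℕ) (b : Fin ℓ → ℕ) : Type _ :=
  MultilinearMap ℂ (fun _ : Fin a => A) (MultilinearMap ℂ (fun _ : Σ i : Fin ℓ, Fin (b i) => B) ℂ)

/-- The value of the form at `(α, β₁, …, β_ℓ)`. -/
def Form.eval {a : ℕ} {b : Fin ℓ → ℕ} (T : Form A B ℓ a b) (α : A) (β : Fin ℓ → B) : ℂ :=
  T (fun _ => α) (fun q => β q.1)

variable {G : Type*} [Group G] (ρA : Representation ℂ G A) (ρB : Representation ℂ G B)

/-- Semistability for `𝒪(a) ⊠ 𝒪(b) ⊠ ⋯ ⊠ 𝒪(b)`: some invariant section of a positive power of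
this line bundle does not vanish at the point. -/
def IsSemistable (a b : ℕ) (α : A) (β : Fin ℓ → B) : Prop :=
  ∃ (m : ℕ) (_ : 0 < m) (T : Form A B ℓ (m * a) (fun _ => m * b)),
    (∀ (t : G) (α' : A) (β' : Fin ℓ → B),
      T.eval (ρA t α') (fun i => ρB t (β' i)) = T.eval α' β') ∧
    T.eval α β ≠ 0

/-- `(α', β')` lies, as a point of the product of projective spaces, in the `G`-orbit of
`(α, β)`. -/
def InOrbit (α : A) (β : Fin ℓ → B) (α' : A) (β' : Fin ℓ → B) : Prop :=
  ∃ (t : G) (c : ℂˣ) (d : Fin ℓ → ℂˣ),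
    α' = (c : ℂ) • ρA t α ∧ ∀ i, β' i = (d i : ℂ) • ρB t (β i)

/-- `(α', β')` lies in the Zariski closure of the `G`-orbit of `(α, β)`: every multihomogeneous
form that vanishes on the orbit vanishes at `(α', β')`. -/
def InOrbitClosure (α : A) (β : Fin ℓ → B) (α' : A) (β' : Fin ℓ → B) : Prop :=
  ∀ (a : ℕ) (b : Fin ℓ → ℕ) (T : Form A B ℓ a b),
    (∀ t : G, T.eval (ρA t α) (fun i => ρB t (β i)) = 0) → T.eval α' β' = 0

/-- Stability: the point is semistable, its orbit is closed in the semistable locus, and its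
stabilizer is finite. -/
def IsStable (a b : ℕ) (α : A) (β : Fin ℓ → B) : Prop :=
  IsSemistable ρA ρB a b α β ∧
  (∀ (α' : A) (β' : Fin ℓ → B), IsSemistable ρA ρB a b α' β' →
    InOrbitClosure ρA ρB α β α' β' → InOrbit ρA ρB α β α' β') ∧
  {t : G | ∃ (c : ℂˣ) (d : Fin ℓ → ℂˣ),
    ρA t α = (c : ℂ) • α ∧ ∀ i, ρB t (β i) = (d i : ℂ) • β i}.Finite

end GIT

/-! ### The `ℂ*`-action and the point attached to a framed bundle -/

section Action

variable (V : Type*) [AddCommGroup V] [Module ℂ V] (n : ℕ)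

/-- The action of a group on `⋀ⁿ M` induced by an action on `M`. -/
def extAct {G M : Type*} [Monoid G] [AddCommGroup M] [Module ℂ M] (ρ : Representation ℂ G M)
    (n : ℕ) : Representation ℂ G (⋀[ℂ]^n M) where
  toFun t := exteriorPower.map n (ρ t)
  map_one' := by
    rw [map_one]
    exact exteriorPower.map_id
  map_mul' s t := by
    rw [map_mul]
    exact (exteriorPower.map_comp _ _)

/-- Precomposition with an action of a commutative group; this is again an action. -/
def preAct {G M D : Type*} [CommMonoid G] [AddCommGroup M] [Module ℂ M] [AddCommGroup D]
    [Module ℂ D] (ρ : Representation ℂ G M) : Representation ℂ G (M →ₗ[ℂ] D) where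
  toFun t := LinearMap.lcomp ℂ D (ρ t)
  map_one' := by
    rw [map_one]
    rfl
  map_mul' s t := by
    rw [mul_comm s t, map_mul]
    rfl

/-- The action of `ℂ*` on `V ⊕ ℂⁿ` with weight `-n` on `V` and weight `dim V` on `ℂⁿ`. -/
def cstarAct : Representation ℂ ℂˣ (V × (Fin n → ℂ)) where
  toFun t := LinearMap.prodMap
    (((t ^ (-(n : ℤ)) : ℂˣ) : ℂ) • LinearMap.id)
    (((t ^ (Module.finrank ℂ V) : ℂˣ) : ℂ) • LinearMap.id)
  map_one' := by ext <;> simp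
  map_mul' s t := by
    rw [mul_zpow, mul_pow, Units.val_mul, Units.val_mul, mul_smul, mul_smul]
    rfl

/-- The restriction of that action to `V`. -/
def cstarActV : Representation ℂ ℂˣ V where
  toFun t := ((t ^ (-(n : ℤ)) : ℂˣ) : ℂ) • LinearMap.id
  map_one' := by ext; simp
  map_mul' s t := by
    rw [mul_zpow, Units.val_mul, mul_smul]
    rfl

/-- The induced action on `⋀ⁿ (V ⊕ ℂⁿ)*`. -/
def cstarActQ : Representation ℂ ℂˣ (⋀[ℂ]^n (Module.Dual ℂ (V × (Fin n → ℂ)))) :=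
  extAct (preAct (D := ℂ) (cstarAct V n)) n

/-- The induced action on `Hom(⋀ⁿ V, D)`. -/
def cstarActP (D : Type*) [AddCommGroup D] [Module ℂ D] :
    Representation ℂ ℂˣ (⋀[ℂ]^n V →ₗ[ℂ] D) :=
  preAct (extAct (cstarActV V n) n)

end Action

/-- `β` is a Plücker vector `b₁ ∧ ⋯ ∧ bₙ` of the `n`-dimensional subspace `S` with basis `bⱼ`. -/
def IsPlucker {M : Type*} [AddCommGroup M] [Module ℂ M] {n : ℕ} (S : Submodule ℂ M)
    (β : ⋀[ℂ]^n M) : Prop :=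
  ∃ b : Module.Basis (Fin n) ℂ S, β = exteriorPower.ιMulti ℂ n (fun j => (b j : M))

section Framed

variable {X : Type*} [TopologicalSpace X] [ChartedSpace ℂ X]
variable (F : Type*) [NormedAddCommGroup F] [NormedSpace ℂ F] [FiniteDimensional ℂ F]
variable (E : X → Type*) [∀ x, AddCommGroup (E x)] [∀ x, Module ℂ (E x)]
  [TopologicalSpace (TotalSpace F E)] [∀ x, TopologicalSpace (E x)]
  [FiberBundle F E] [VectorBundle ℂ F E] [ContMDiffVectorBundle ω F E 𝓘(ℂ, ℂ)]
variable {n ℓ : ℕ} (P : Fin ℓ → X) (h : ∀ i, Submodule ℂ (E (P i) × (Fin n → ℂ)))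

/-- The subspace of `(V ⊕ ℂⁿ)*`, `V = H⁰(X, E)`, attached to the plane `h ⊂ E_x ⊕ ℂⁿ`: the
annihilator of the preimage of `h` under `V ⊕ ℂⁿ → E_x ⊕ ℂⁿ`. -/
def framingDual (x : X) (h : Submodule ℂ (E x × (Fin n → ℂ))) :
    Submodule ℂ (Module.Dual ℂ (HolSections F E × (Fin n → ℂ))) :=
  (h.comap ((evalAt F E x).prodMap LinearMap.id)).dualAnnihilator

/-- `ℂ*`-semistability, for the polarization `𝒪(a) ⊠ 𝒪(b) ⊠ ⋯ ⊠ 𝒪(b)`, of the point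
`(α, β₁, …, β_ℓ)` of `ℙ(Hom(⋀ⁿ V, H⁰(det E))) × ℙ(⋀ⁿ (V ⊕ ℂⁿ)*)^ℓ` attached to `(E, h)`. -/
def IsCStarSemistable (a b : ℕ) : Prop :=
  ∃ β : Fin ℓ → ⋀[ℂ]^n (Module.Dual ℂ (HolSections F E × (Fin n → ℂ))),
    (∀ i, IsPlucker (framingDual F E (P i) (h i)) (β i)) ∧
    GIT.IsSemistable (cstarActP (HolSections F E) n (WedgeSections F E n))
      (cstarActQ (HolSections F E) n) a b (detMap F E n) β

/-- `ℂ*`-stability of the same point. -/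
def IsCStarStable (a b : ℕ) : Prop :=
  ∃ β : Fin ℓ → ⋀[ℂ]^n (Module.Dual ℂ (HolSections F E × (Fin n → ℂ))),
    (∀ i, IsPlucker (framingDual F E (P i) (h i)) (β i)) ∧
    GIT.IsStable (cstarActP (HolSections F E) n (WedgeSections F E n))
      (cstarActQ (HolSections F E) n) a b (detMap F E n) β

end Framed

/-- `s = dim (g ∩ W)` for a plane `g ⊂ W ⊕ ℂⁿ`. -/
def sNumber {W : Type*} [AddCommGroup W] [Module ℂ W] {n : ℕ}
    (g : Submodule ℂ (W × (Fin n → ℂ))) : ℕ :=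
  Module.finrank ℂ (g ⊓ LinearMap.range (LinearMap.inl ℂ W (Fin n → ℂ)) :
    Submodule ℂ (W × (Fin n → ℂ)))

/-- `t = dim (g ∩ ℂⁿ)` for a plane `g ⊂ W ⊕ ℂⁿ`. -/
def tNumber {W : Type*} [AddCommGroup W] [Module ℂ W] {n : ℕ}
    (g : Submodule ℂ (W × (Fin n → ℂ))) : ℕ :=
  Module.finrank ℂ (g ⊓ LinearMap.range (LinearMap.inr ℂ W (Fin n → ℂ)) :
    Submodule ℂ (W × (Fin n → ℂ)))

/-! ### The stability parameters -/

/-- `γ = 2n / (ℓn - 2δ₀)`. -/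
def gammaParam (n ℓ : ℕ) (δ₀ : ℤ) : ℚ := 2 * n / (ℓ * n - 2 * δ₀)

/-- `μ = 2 + δ₀/n - γℓ`. -/
def muParam (n ℓ : ℕ) (δ₀ : ℤ) : ℚ := 2 + δ₀ / n - gammaParam n ℓ δ₀ * ℓ

/-- `η = γ / (k - g + μ)`. -/
def etaParam (n ℓ g : ℕ) (δ₀ : ℤ) (k : ℕ) : ℚ :=
  gammaParam n ℓ δ₀ / (k - g + muParam n ℓ δ₀)

end

noncomputable section

/-! ### Forms on `A × B^ℓ` and their weights under a `ℂ*`-action -/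

/-! The group is a torus of rank one acting through explicit weights, so (semi)stability can be read
off from the weights occurring at the point, without appeal to a general Hilbert–Mumford theorem.
Write `p = dim V`. An element `t` acts on `α` by `t^(-n²)`. On the part of `⋀ⁿ (V ⊕ ℂⁿ)*` with
exactly `j` factors from `(ℂⁿ)*` it acts by `t^((n+p)j - n²)`. This situation is abstracted in
`GIT.IsWeightAction` with `u = n²` and `q = n + p`.

Suppose that the nonzero components of `β_i` lie in degrees from `s_i` to `r_i`, with both ends
attained. An invariant form of multidegree `(ma, mb, …, mb)` only sees products of components of
total degree `D` with `qD = um(a + bℓ)`. Such a product can be nonzero at the point for some `m > 0`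
exactly when `bq ∑ s_i ≤ u(a + bℓ) ≤ bq ∑ r_i` (`isSemistable_iff`). If one of these is an equality,
the limit in that direction is semistable and lies in the orbit closure, so either the orbit is not
closed or the stabilizer is all of `ℂ*` (`not_isStable_of_extreme`). If both are strict, the
binomial equations of the orbit force every semistable point of its closure into the orbit
(`inOrbit_of_inOrbitClosure`), and the stabilizer consists of roots of unity.

For a Plücker vector, linear algebra identifies the extreme degrees as `dim (g_i ∩ E_{p_i})` and `n
- dim (g_i ∩ ℂⁿ)` (`lowestWeight_framingDual`, `highestWeight_framingDual`). Finally the choice of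
`η` gives `b(n + p) = nγ(a + bℓ)`, while `ℓn/2 - δ₀ = n/γ`. Hence `n²(a + bℓ) = b(n + p)(ℓn/2 -
δ₀)`, and the weight inequalities become the stated ones (`weight_identity`, `criterion_iff`). -/

/-- Comparison of coefficients for exponential sums that agree with a monomial on `ℂ*`. -/
theorem sum_coeff_of_forall_units {R : Type*} [Fintype R] (c : R → ℂ) (e : R → ℕ) (C : ℂ) (K : ℕ)
    (h : ∀ t : ℂˣ, ∑ r, (t : ℂ) ^ e r * c r = C * (t : ℂ) ^ K) (N : ℕ) :
    (∑ r, if e r = N then c r else 0) = if N = K then C else 0 := by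
  classical
  let f : Polynomial ℂ :=
    (∑ r, Polynomial.C (c r) * Polynomial.X ^ e r) - Polynomial.C C * Polynomial.X ^ K
  have hf : f = 0 := by
    refine Polynomial.eq_zero_of_infinite_isRoot f (Set.Infinite.mono ?_
      (Set.infinite_univ.sdiff (Set.finite_singleton (0 : ℂ))))
    intro z hz
    have hz0 : z ≠ 0 := by simpa using hz
    have := h (Units.mk0 z hz0)
    simp only [Units.val_mk0] at this
    simp only [Set.mem_ofPred_eq, Polynomial.IsRoot, f, Polynomial.eval_sub,
      Polynomial.eval_finsetSum, Polynomial.eval_mul, Polynomial.eval_C, Polynomial.eval_pow,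
      Polynomial.eval_X, ← this]
    simp [mul_comm]
  have h2 : f.coeff N = 0 := by simp [hf]
  simp only [f, Polynomial.coeff_sub, Polynomial.finsetSum_coeff, Polynomial.coeff_C_mul,
    Polynomial.coeff_X_pow, mul_ite, mul_one, mul_zero] at h2
  rw [sub_eq_zero] at h2
  simpa [eq_comm] using h2

namespace GIT

variable {A B : Type*} [AddCommGroup A] [Module ℂ A] [AddCommGroup B] [Module ℂ B] {ℓ : ℕ}

/-- The form `f(α)^a ∏ F_{ij}(β_i)^{m_{ij}}`. -/
def monomialForm {J a : ℕ} (f : A →ₗ[ℂ] ℂ) (F : Fin ℓ → Fin J → B →ₗ[ℂ] ℂ)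
    {b : Fin ℓ → ℕ} (m : Fin ℓ → Fin J → ℕ) (h : ∀ i, ∑ j, m i j = b i) : Form A B ℓ a b :=
  ((MultilinearMap.mkPiAlgebra ℂ (Fin a) ℂ).compLinearMap fun _ => f).smulRight
    ((MultilinearMap.mkPiAlgebra ℂ (Σ i : Fin ℓ, Fin (b i)) ℂ).compLinearMap
      fun x => F x.1 (finSigmaFinEquiv.symm (Fin.cast (h x.1).symm x.2)).1)

theorem monomialForm_eval {J a : ℕ} (f : A →ₗ[ℂ] ℂ) (F : Fin ℓ → Fin J → B →ₗ[ℂ] ℂ)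
    {b : Fin ℓ → ℕ} (m : Fin ℓ → Fin J → ℕ) (h : ∀ i, ∑ j, m i j = b i) (α : A) (β : Fin ℓ → B) :
    (monomialForm (a := a) f F m h).eval α β = f α ^ a * ∏ i, ∏ j, F i j (β i) ^ m i j := by
  obtain rfl : b = fun i => ∑ j, m i j := funext fun i => (h i).symm
  simp only [monomialForm, Form.eval, MultilinearMap.smulRight_apply,
    MultilinearMap.compLinearMap_apply, MultilinearMap.mkPiAlgebra_apply, smul_apply,
    Finset.prod_const, Finset.card_univ, Fintype.card_fin, smul_eq_mul, Fin.cast_refl, id]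
  congr 1
  rw [Fintype.prod_sigma]
  refine Finset.prod_congr rfl fun i _ => ?_
  rw [← finSigmaFinEquiv.prod_comp, Fintype.prod_sigma]
  simp

/-- `ℂ*` acts on `A` by the character `t ↦ t^{-u}` and on `B` with the weights `qj - u`, `j ≤ n`,
the weight spaces being the ranges of the projections `pr j`. -/
structure IsWeightAction (ρA : Representation ℂ ℂˣ A) (ρB : Representation ℂ ℂˣ B) {n : ℕ}
    (u q : ℕ) (pr : Fin (n + 1) → B →ₗ[ℂ] B) : Prop where
  pos : 0 < q
  actA : ∀ t α, ρA t α = ((t ^ (-(u : ℤ)) : ℂˣ) : ℂ) • α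
  actB : ∀ t x, ρB t x =
    ((t ^ (-(u : ℤ)) : ℂˣ) : ℂ) • ∑ j : Fin (n + 1), (t : ℂ) ^ (q * (j : ℕ)) • pr j x
  proj : ∀ i j x, pr i (pr j x) = if i = j then pr j x else 0

variable {ρA : Representation ℂ ℂˣ A} {ρB : Representation ℂ ℂˣ B} {n u q : ℕ}
  {pr : Fin (n + 1) → B →ₗ[ℂ] B}

theorem IsWeightAction.sum_proj (H : IsWeightAction ρA ρB u q pr) (x : B) : ∑ j, pr j x = x := by
  have := H.actB 1 x
  simpa using this.symm

theorem IsWeightAction.proj_act (H : IsWeightAction ρA ρB u q pr) (j : Fin (n + 1)) (t : ℂˣ)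
    (x : B) :
    pr j (ρB t x) = (((t ^ (-(u : ℤ)) : ℂˣ) : ℂ) * (t : ℂ) ^ (q * (j : ℕ))) • pr j x := by
  rw [H.actB, map_smul, map_sum, mul_smul]
  congr 1
  simp [H.proj]

/-- Multilinear expansion over all choices `r` of a weight component in each `β`-slot. Apart from
the common character, the value at the moved point is a polynomial in `t` whose exponents are the
total weights. -/
theorem IsWeightAction.eval_act (H : IsWeightAction ρA ρB u q pr) {a : ℕ} {b : Fin ℓ → ℕ}
    (T : Form A B ℓ a b) (α : A) (β : Fin ℓ → B) (t : ℂˣ) :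
    T.eval (ρA t α) (fun i => ρB t (β i)) =
      ((t ^ (-(u : ℤ)) : ℂˣ) : ℂ) ^ (a + ∑ i, b i) *
        ∑ r : (Σ i : Fin ℓ, Fin (b i)) → Fin (n + 1),
          (t : ℂ) ^ (q * ∑ x, (r x : ℕ)) * T (fun _ => α) (fun x => pr (r x) (β x.1)) := by
  classical
  simp only [Form.eval, H.actA, H.actB]
  rw [MultilinearMap.map_smul_univ, MultilinearMap.map_smul_univ, smul_apply,
    MultilinearMap.map_sum]
  simp only [MultilinearMap.map_smul_univ]
  simp [pow_add, mul_assoc, Finset.prod_pow_eq_pow_sum, Finset.mul_sum]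
  exact Finset.sum_congr rfl fun r _ => by ring

theorem character_pow_mul (t : ℂˣ) (u N : ℕ) :
    ((t ^ (-(u : ℤ)) : ℂˣ) : ℂ) ^ N * (t : ℂ) ^ (u * N) = 1 := by
  rw [pow_mul, ← mul_pow, ← Units.val_pow_eq_pow_val, ← Units.val_mul, ← zpow_natCast t u,
    ← zpow_add]
  simp

theorem IsSemistable.ne_zero {a b : ℕ} {α : A} {β : Fin ℓ → B} (ha : 0 < a)
    (h : IsSemistable ρA ρB a b α β) : α ≠ 0 := by
  rintro rfl
  obtain ⟨m, hm, T, -, hne⟩ := h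
  apply hne
  unfold Form.eval
  rw [T.map_coord_zero ⟨0, Nat.mul_pos hm ha⟩ rfl]
  rfl

/-- Invariance leaves only the terms of total weight zero in the expansion of `eval_act`. Since the
form does not vanish at the point, one of them is nonzero, and `r` records the components it uses.
-/
theorem IsWeightAction.exists_weights (H : IsWeightAction ρA ρB u q pr) {a b : ℕ} {α : A}
    {β : Fin ℓ → B} (h : IsSemistable ρA ρB a b α β) :
    ∃ m : ℕ, 0 < m ∧ ∃ r : Fin ℓ → Fin (m * b) → Fin (n + 1),
      (∀ i k, pr (r i k) (β i) ≠ 0) ∧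
      q * ∑ i, ∑ k, (r i k : ℕ) = u * (m * (a + b * ℓ)) := by
  obtain ⟨m, hm, T, hT, hne⟩ := h
  refine ⟨m, hm, ?_⟩
  -- Multiplying the invariance identity by `t^(u·m(a+bℓ))` clears the negative powers of `t`; the
  -- coefficient at that exponent is the value of the form.
  have key := sum_coeff_of_forall_units
    (fun r : (Σ i : Fin ℓ, Fin (m * b)) → Fin (n + 1) =>
      T (fun _ => α) (fun x => pr (r x) (β x.1)))
    (fun r => q * ∑ x, (r x : ℕ)) (T.eval α β) (u * (m * (a + b * ℓ))) (fun t => by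
      rw [← hT t α β, H.eval_act T α β t]
      have h1 : ((t ^ (-(u : ℤ)) : ℂˣ) : ℂ) ^ (m * a + ∑ _i : Fin ℓ, m * b) *
          (t : ℂ) ^ (u * (m * (a + b * ℓ))) = 1 := by
        have : m * a + ∑ _i : Fin ℓ, m * b = m * (a + b * ℓ) := by
          simp; ring
        rw [this, character_pow_mul]
      linear_combination -(∑ r : (Σ i : Fin ℓ, Fin (m * b)) → Fin (n + 1),
        (t : ℂ) ^ (q * ∑ x, (r x : ℕ)) * T (fun _ => α) (fun x => pr (r x) (β x.1))) * h1) (u * (m * (a + b * ℓ)))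
  rw [if_pos rfl] at key
  rw [← key] at hne
  obtain ⟨r, -, hr⟩ := Finset.exists_ne_zero_of_sum_ne_zero hne
  simp only [ne_eq, ite_eq_right_iff, Classical.not_imp] at hr
  refine ⟨fun i k => r ⟨i, k⟩, fun i k h0 => hr.2 ?_, ?_⟩
  · exact MultilinearMap.map_coord_zero _ (⟨i, k⟩ : Σ _ : Fin ℓ, Fin (m * b)) h0
  · rw [← hr.1, Fintype.sum_sigma]

/-- A functional which takes the value `1` at `x` if `x ≠ 0`. -/
theorem exists_functional (x : B) : ∃ f : B →ₗ[ℂ] ℂ, x ≠ 0 → f x = 1 := by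
  by_cases hx : x = 0
  · exact ⟨0, fun h => (h hx).elim⟩
  · obtain ⟨f, hf⟩ : ∃ f : Module.Dual ℂ B, f x ≠ 0 := by
      by_contra! h
      exact hx ((Module.forall_dual_apply_eq_zero_iff ℂ x).1 h)
    exact ⟨(f x)⁻¹ • f, fun _ => by simp [hf]⟩

/-- The required section is a monomial in functionals normalized to be `1` on the components that
occur; the weight equation `hw` is exactly its invariance. -/
theorem IsWeightAction.isSemistable_of_exponents (H : IsWeightAction ρA ρB u q pr)
    {a b : ℕ} {α : A} {β : Fin ℓ → B} (hα : α ≠ 0)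
    {M : ℕ} (hM : 0 < M) (m : Fin ℓ → Fin (n + 1) → ℕ) (hm : ∀ i, ∑ j, m i j = M * b)
    (hw : q * ∑ i, ∑ j, m i j * (j : ℕ) = u * (M * (a + b * ℓ)))
    (hβ : ∀ i j, m i j ≠ 0 → pr j (β i) ≠ 0) : IsSemistable ρA ρB a b α β := by
  obtain ⟨f, hf⟩ := exists_functional α
  choose F hF using fun (i : Fin ℓ) (j : Fin (n + 1)) => exists_functional (pr j (β i))
  refine ⟨M, hM, monomialForm f (fun i j => F i j ∘ₗ pr j) m hm, fun t α' β' => ?_, ?_⟩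
  · rw [monomialForm_eval, monomialForm_eval, H.actA]
    simp only [LinearMap.comp_apply, H.proj_act, map_smul, smul_eq_mul, mul_pow,
      Finset.prod_mul_distrib, Finset.prod_pow_eq_pow_sum, ← pow_mul, hm]
    have : (t : ℂ) ^ (∑ i : Fin ℓ, ∑ j : Fin (n + 1), q * (j : ℕ) * m i j) =
        (t : ℂ) ^ (u * (M * (a + b * ℓ))) := by
      rw [← hw]
      simp only [Finset.mul_sum]
      congr 1
      refine Finset.sum_congr rfl fun i _ => Finset.sum_congr rfl fun j _ => by ring
    rw [this]
    have h1 : ((t ^ (-(u : ℤ)) : ℂˣ) : ℂ) ^ (M * a) * ((t ^ (-(u : ℤ)) : ℂˣ) : ℂ) ^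
        (∑ _i : Fin ℓ, M * b) * (t : ℂ) ^ (u * (M * (a + b * ℓ))) = 1 := by
      have : M * a + ∑ _i : Fin ℓ, M * b = M * (a + b * ℓ) := by
        simp; ring
      rw [← pow_add, this, character_pow_mul]
    linear_combination (f α' ^ (M * a) * ∏ i, ∏ j, F i j (pr j (β' i)) ^ m i j) * h1
  · rw [monomialForm_eval, hf hα, one_pow, one_mul]
    refine Finset.prod_ne_zero_iff.2 fun i _ => Finset.prod_ne_zero_iff.2 fun j _ => ?_
    by_cases h0 : m i j = 0
    · simp [h0]
    · simp [hF i j (hβ i j h0)]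

end GIT

/-! ### Exponents of invariant monomials and multiplicative relations. -/

namespace GIT

variable {A B : Type*} [AddCommGroup A] [Module ℂ A] [AddCommGroup B] [Module ℂ B] {ℓ : ℕ}
variable {ρA : Representation ℂ ℂˣ A} {ρB : Representation ℂ ℂˣ B} {n u q : ℕ}
  {pr : Fin (n + 1) → B →ₗ[ℂ] B}

/-- A weight between the extremes is attained by a monomial in the extremal coordinates. -/
theorem exists_exponents {s r : Fin ℓ → Fin (n + 1)} {b q W : ℕ} (hq : 0 < q)
    (hs : b * q * ∑ i, (s i : ℕ) ≤ W) (hr : W ≤ b * q * ∑ i, (r i : ℕ)) :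
    ∃ M : ℕ, 0 < M ∧ ∃ m : Fin ℓ → Fin (n + 1) → ℕ, (∀ i, ∑ j, m i j = M * b) ∧
      q * ∑ i, ∑ j, m i j * (j : ℕ) = M * W ∧
      (∀ i j, m i j ≠ 0 → j = s i ∨ j = r i) ∧
      (b * q * ∑ i, (s i : ℕ) < W → W < b * q * ∑ i, (r i : ℕ) →
        ∀ i, m i (s i) ≠ 0 ∧ m i (r i) ≠ 0) := by
  obtain ⟨M, x, y, hM, hxy, hW, hpos⟩ : ∃ M x y : ℕ, 0 < M ∧ x + y = M * b ∧
      q * (x * ∑ i, (s i : ℕ) + y * ∑ i, (r i : ℕ)) = M * W ∧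
      (b * q * ∑ i, (s i : ℕ) < W → W < b * q * ∑ i, (r i : ℕ) → x ≠ 0 ∧ y ≠ 0) := by
    generalize ∑ i, (s i : ℕ) = S at *
    generalize ∑ i, (r i : ℕ) = R at *
    rcases hs.eq_or_lt with h | h
    · exact ⟨1, b, 0, one_pos, by simp, by rw [← h]; ring, fun h' => absurd h h'.ne⟩
    · have hSR : S < R := by
        by_contra! hle
        exact absurd (h.trans_le hr) (not_lt.2 (Nat.mul_le_mul_left _ hle))
      obtain ⟨D, rfl⟩ := Nat.exists_eq_add_of_lt hSR
      obtain ⟨y, hy⟩ := Nat.exists_eq_add_of_le hs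
      obtain ⟨x, hx⟩ := Nat.exists_eq_add_of_le hr
      -- Linear interpolation of `W` between `bqS` and `bqR`, with `R - S = D + 1`: the exponents
      -- are `x = bqR - W` at the lower end and `y = W - bqS` at the upper end, so `x + y = q(R -
      -- S)b`.
      refine ⟨q * (D + 1), x, y, by positivity, ?_, ?_, fun _ h2 => by omega⟩
      · nlinarith
      · zify at *
        have e1 : (y : ℤ) = W - b * q * S := by linarith
        have e2 : (x : ℤ) = b * q * (S + D + 1) - W := by linarith
        rw [e1, e2]
        ring
  refine ⟨M, hM, fun i j => (if j = s i then x else 0) + (if j = r i then y else 0),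
    fun i => ?_, ?_, fun i j h => ?_, fun h1 h2 i => ?_⟩
  · simp [Finset.sum_add_distrib, hxy]
  · rw [← hW]
    simp [add_mul, Finset.sum_add_distrib, Finset.mul_sum]
  · by_contra! h'
    simp [h'.1, h'.2] at h
  · obtain ⟨hx, hy⟩ := hpos h1 h2
    simp [hx, hy]

/-- A family of nonzero complex numbers satisfying all multiplicative relations satisfied by
`z ^ e k` is of this form. -/
theorem exists_zpow_eq {K : Type*} [Fintype K] (x : K → ℂˣ) (e : K → ℤ)
    (h : ∀ m : K → ℤ, ∑ k, m k * e k = 0 → ∏ k, x k ^ m k = 1) :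
    ∃ z : ℂˣ, ∀ k, x k = z ^ e k := by
  classical
  let w : (K → ℤ) →+ ℤ :=
    { toFun := fun m => ∑ k, m k * e k
      map_zero' := by simp
      map_add' := fun a b => by simp [add_mul, Finset.sum_add_distrib] }
  obtain ⟨d, hd⟩ := Int.subgroup_cyclic w.range
  have hdm : d ∈ w.range := by rw [hd]; exact AddSubgroup.subset_closure rfl
  obtain ⟨m, hm⟩ := hdm
  -- The character `m ↦ ∏ x_k ^ m_k` is trivial on the kernel of `w`, so it factors through the
  -- image `dℤ`. It is determined by its value at a preimage of `d`, of which `z` is a `d`-th root.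
  have hroot : ∃ z : ℂˣ, z ^ d = ∏ k, x k ^ m k := by
    rcases eq_or_ne d 0 with rfl | hd0
    · exact ⟨1, by rw [h m hm]; simp⟩
    · obtain ⟨z, hz⟩ := IsAlgClosed.exists_pow_nat_eq ((∏ k, x k ^ m k : ℂˣ) : ℂ)
        (Int.natAbs_pos.2 hd0)
      have hz0 : z ≠ 0 := by
        rintro rfl
        rw [zero_pow (Int.natAbs_pos.2 hd0).ne'] at hz
        exact (Units.ne_zero _) hz.symm
      have hz' : (Units.mk0 z hz0) ^ d.natAbs = ∏ k, x k ^ m k := Units.ext (by simpa using hz)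
      rcases Int.natAbs_eq d with h1 | h1
      · exact ⟨Units.mk0 z hz0, by rw [h1, zpow_natCast, hz']⟩
      · exact ⟨(Units.mk0 z hz0)⁻¹, by rw [h1, inv_zpow, zpow_neg, inv_inv, zpow_natCast, hz']⟩
  obtain ⟨z, hz⟩ := hroot
  refine ⟨z, fun k => ?_⟩
  have hk : e k ∈ w.range := ⟨Pi.single k 1, by simp [w, Pi.single_apply]⟩
  rw [hd, AddSubgroup.mem_closure_singleton] at hk
  obtain ⟨c, hc⟩ := hk
  have hm' : ∑ i, m i * e i = d := hm
  -- With `e k = c·d`, the vector `δ_k - c·m` is in the kernel of `w`, which gives `x k = (z^d)^c`.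
  have := h (fun i => Pi.single (M := fun _ => ℤ) k 1 i - c * m i) (by
    simp only [sub_mul, Finset.sum_sub_distrib, mul_assoc, ← Finset.mul_sum, hm', Pi.single_apply,
      ite_mul, one_mul, zero_mul, Finset.sum_ite_eq', Finset.mem_univ, if_true]
    rw [← hc, smul_eq_mul, sub_self])
  simp only [zpow_sub, Finset.prod_mul_distrib, Finset.prod_inv_distrib, Pi.single_apply] at this
  rw [mul_inv_eq_one] at this
  rw [← hc, smul_eq_mul, mul_comm, zpow_mul, hz, ← Finset.prod_zpow]
  simpa [mul_comm c, zpow_mul] using this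

end GIT

/-! ### Orbit closures and their binomial equations. -/

namespace GIT

variable {A B : Type*} [AddCommGroup A] [Module ℂ A] [AddCommGroup B] [Module ℂ B] {ℓ : ℕ}
variable {ρA : Representation ℂ ℂˣ A} {ρB : Representation ℂ ℂˣ B} {n u q : ℕ}
  {pr : Fin (n + 1) → B →ₗ[ℂ] B}

theorem exists_smul_of_forall_functional {x y : B} (h : ∀ f : B →ₗ[ℂ] ℂ, f x = 0 → f y = 0) :
    ∃ c : ℂ, y = c • x := by
  by_contra! hc
  have hy : y ∉ Submodule.span ℂ {x} := fun hy => by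
    obtain ⟨c, rfl⟩ := Submodule.mem_span_singleton.1 hy
    exact hc c rfl
  obtain ⟨f, hf, hf'⟩ := Submodule.exists_dual_map_eq_bot_of_notMem hy inferInstance
  refine hf (h f ?_)
  have : f x ∈ (Submodule.span ℂ {x}).map f :=
    Submodule.mem_map_of_mem (Submodule.mem_span_singleton_self x)
  simpa [hf'] using this

theorem IsWeightAction.monomial_act (H : IsWeightAction ρA ρB u q pr)
    (F : Fin ℓ → Fin (n + 1) → B →ₗ[ℂ] ℂ) (m : Fin ℓ → Fin (n + 1) → ℕ) (β : Fin ℓ → B) (t : ℂˣ) :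
    ∏ i, ∏ j, F i j (pr j (ρB t (β i))) ^ m i j =
      ((t ^ (-(u : ℤ)) : ℂˣ) : ℂ) ^ (∑ i, ∑ j, m i j) * (t : ℂ) ^ (q * ∑ i, ∑ j, m i j * (j : ℕ)) *
        ∏ i, ∏ j, F i j (pr j (β i)) ^ m i j := by
  simp only [H.proj_act, map_smul, smul_eq_mul, mul_pow, Finset.prod_mul_distrib,
    Finset.prod_pow_eq_pow_sum, ← pow_mul, Finset.mul_sum]
  congr 3
  exact Finset.sum_congr rfl fun i _ => Finset.sum_congr rfl fun j _ => by ring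

/-- Two monomials of equal multidegree and weight are multiplied by the same power of `t` along the
orbit. Their difference therefore vanishes on the orbit once it vanishes at the base point, and
hence on the closure. -/
theorem IsWeightAction.monomial_eq_of_inOrbitClosure (H : IsWeightAction ρA ρB u q pr)
    {α α' : A} {β β' : Fin ℓ → B} (hc : InOrbitClosure ρA ρB α β α' β')
    (F : Fin ℓ → Fin (n + 1) → B →ₗ[ℂ] ℂ) {m m' : Fin ℓ → Fin (n + 1) → ℕ}
    (hrow : ∀ i, ∑ j, m i j = ∑ j, m' i j)
    (hw : ∑ i, ∑ j, m i j * (j : ℕ) = ∑ i, ∑ j, m' i j * (j : ℕ))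
    (hF : ∏ i, ∏ j, F i j (pr j (β i)) ^ m i j = ∏ i, ∏ j, F i j (pr j (β i)) ^ m' i j) :
    ∏ i, ∏ j, F i j (pr j (β' i)) ^ m i j = ∏ i, ∏ j, F i j (pr j (β' i)) ^ m' i j := by
  have h := hc 0 (fun i => ∑ j, m i j)
    (monomialForm 0 (fun i j => F i j ∘ₗ pr j) m (fun _ => rfl) -
      monomialForm 0 (fun i j => F i j ∘ₗ pr j) m' (fun i => (hrow i).symm))
  have hsub : ∀ (a : ℕ) (b : Fin ℓ → ℕ) (T T' : Form A B ℓ a b) (x : A) (y : Fin ℓ → B),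
      (T - T').eval x y = T.eval x y - T'.eval x y := fun _ _ _ _ _ _ => rfl
  simp only [hsub, monomialForm_eval, pow_zero, one_mul, LinearMap.comp_apply, sub_eq_zero] at h
  refine h fun t => ?_
  rw [H.monomial_act, H.monomial_act, hF, hw, Finset.sum_congr rfl fun i _ => hrow i]

/-- The orbit moves each weight component only along a line, and the linear equations of that line
pass to the closure. -/
theorem IsWeightAction.exists_smul_of_inOrbitClosure (H : IsWeightAction ρA ρB u q pr)
    {α α' : A} {β β' : Fin ℓ → B} (hc : InOrbitClosure ρA ρB α β α' β') (i : Fin ℓ)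
    (j : Fin (n + 1)) : ∃ y : ℂ, pr j (β' i) = y • pr j (β i) := by
  refine exists_smul_of_forall_functional fun f hf => ?_
  let m : Fin ℓ → Fin (n + 1) → ℕ := fun i' j' => if i' = i then if j' = j then 1 else 0 else 0
  have hm : ∀ β : Fin ℓ → B, ∏ i', ∏ j', f (pr j' (β i')) ^ m i' j' = f (pr j (β i)) := by
    intro β
    rw [Finset.prod_eq_single i (fun i' _ h => by simp [m, h]) (by simp),
      Finset.prod_eq_single j (fun j' _ h => by simp [m, h]) (by simp)]
    simp [m]
  have h := hc 0 (fun i => ∑ j, m i j)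
    (monomialForm 0 (fun i j => f ∘ₗ pr j) m (fun _ => rfl))
  simp only [monomialForm_eval, pow_zero, one_mul, LinearMap.comp_apply, hm] at h
  exact h fun t => by rw [H.proj_act, map_smul, hf, smul_zero]

theorem IsWeightAction.exists_smul_of_inOrbitClosure_left (H : IsWeightAction ρA ρB u q pr)
    {α α' : A} {β β' : Fin ℓ → B} (hc : InOrbitClosure ρA ρB α β α' β') :
    ∃ c : ℂ, α' = c • α := by
  refine exists_smul_of_forall_functional fun f hf => ?_
  have h := hc 1 (fun _ => ∑ _j : Fin 0, 0)
    (monomialForm f (fun _ _ => 0) (fun _ _ => 0) (fun _ => rfl))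
  simp only [monomialForm_eval, pow_one, pow_zero, Finset.prod_const_one, mul_one] at h
  exact h fun t => by rw [H.actA, map_smul, hf, smul_zero]

/-- If the relevant coordinates of a point satisfy all the binomial relations of a `ℂ*`-orbit,
then they are the coordinates of a point of the orbit. -/
theorem exists_parameter (D : Fin ℓ → Fin (n + 1) → Prop) (y : Fin ℓ → Fin (n + 1) → ℂ)
    (s : Fin ℓ → Fin (n + 1)) (hs : ∀ i, D i (s i)) (hy : ∀ i j, D i j → y i j ≠ 0)
    (rel : ∀ m m' : Fin ℓ → Fin (n + 1) → ℕ, (∀ i j, m i j ≠ 0 → D i j) →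
      (∀ i j, m' i j ≠ 0 → D i j) → (∀ i, ∑ j, m i j = ∑ j, m' i j) →
      ∑ i, ∑ j, m i j * (j : ℕ) = ∑ i, ∑ j, m' i j * (j : ℕ) →
      ∏ i, ∏ j, y i j ^ m i j = ∏ i, ∏ j, y i j ^ m' i j) :
    ∃ z : ℂˣ, ∀ i j, D i j → y i j = ((z ^ ((j : ℤ) - (s i : ℤ)) : ℂˣ) : ℂ) * y i (s i) := by
  classical
  -- Dividing by the reference coordinate `y i (s i)` removes the projective scaling in each factor.
  -- Outside the support the ratio is set to `1`, with exponent `0` below, so these positions impose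
  -- no condition.
  have hx : ∀ k : Fin ℓ × Fin (n + 1), ∃ x : ℂˣ,
      (D k.1 k.2 → y k.1 k.2 = (x : ℂ) * y k.1 (s k.1)) ∧ (¬ D k.1 k.2 → x = 1) := by
    intro k
    by_cases hk : D k.1 k.2
    · have h0 := hy _ _ (hs k.1)
      exact ⟨Units.mk0 (y k.1 k.2 / y k.1 (s k.1)) (div_ne_zero (hy _ _ hk) h0),
        fun _ => by simp [h0], fun h => (h hk).elim⟩
    · exact ⟨1, fun h => (hk h).elim, fun _ => rfl⟩
  choose x hxD hx1 using hx
  -- A relation among the ratios need not be homogeneous. Padding each monomial at `s i` by the row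
  -- sum of the other one equalizes the multidegrees, and the added reference factors cancel later.
  have expand : ∀ N N' : Fin ℓ → Fin (n + 1) → ℕ, (∀ i j, N i j ≠ 0 → D i j) →
      ∏ i, ∏ j, y i j ^ (N i j + if j = s i then ∑ j', N' i j' else 0) =
        (∏ i, ∏ j, (x (i, j) : ℂ) ^ N i j) * ∏ i, y i (s i) ^ (∑ j, N i j + ∑ j, N' i j) := by
    intro N N' hN
    rw [← Finset.prod_mul_distrib]
    refine Finset.prod_congr rfl fun i _ => ?_
    simp only [pow_add, Finset.prod_mul_distrib, ← mul_assoc]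
    congr 1
    · rw [← Finset.prod_pow_eq_pow_sum, ← Finset.prod_mul_distrib]
      refine Finset.prod_congr rfl fun j _ => ?_
      by_cases h0 : N i j = 0
      · simp [h0]
      · rw [hxD (i, j) (hN i j h0), mul_pow]
    · rw [Finset.prod_eq_single (s i) (fun j _ h => by simp [h]) (by simp)]
      simp
  obtain ⟨z, hz⟩ := exists_zpow_eq x
    (fun k => if D k.1 k.2 then (k.2 : ℤ) - (s k.1 : ℤ) else 0) (fun m hm => by
      -- `N` and `N'` are the positive and negative parts of the integer relation `m`, restricted to
      -- the support.
      let N : Fin ℓ → Fin (n + 1) → ℕ := fun i j => if D i j then (m (i, j)).toNat else 0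
      let N' : Fin ℓ → Fin (n + 1) → ℕ := fun i j => if D i j then (-m (i, j)).toNat else 0
      have hN : ∀ i j, N i j ≠ 0 → D i j := fun i j h => by
        by_contra hD; simp [N, hD] at h
      have hN' : ∀ i j, N' i j ≠ 0 → D i j := fun i j h => by
        by_contra hD; simp [N', hD] at h
      have hdiff : ∀ i j, D i j → ((N i j : ℤ) - N' i j) = m (i, j) := fun i j h => by
        simp only [N, N', h, if_true]; omega
      have hpad : ∀ (N N' : Fin ℓ → Fin (n + 1) → ℕ), (∀ i j, N i j ≠ 0 → D i j) → ∀ i j,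
          (N i j + if j = s i then ∑ j', N' i j' else 0) ≠ 0 → D i j := fun N N' hN i j h => by
        by_cases hj : j = s i
        · exact hj ▸ hs i
        · exact hN i j (by simpa [hj] using h)
      have hrel := rel (fun i j => N i j + if j = s i then ∑ j', N' i j' else 0)
        (fun i j => N' i j + if j = s i then ∑ j', N i j' else 0) (hpad N N' hN) (hpad N' N hN')
        (fun i => by simp [Finset.sum_add_distrib, add_comm]) (by
          have hsum : ∑ i, ∑ j, ((N i j : ℤ) - N' i j) * ((j : ℤ) - (s i : ℤ)) = 0 := by
            rw [← hm, Fintype.sum_prod_type]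
            refine Finset.sum_congr rfl fun i _ => Finset.sum_congr rfl fun j _ => ?_
            by_cases hD : D i j
            · rw [hdiff i j hD]; simp [hD]
            · simp [N, N', hD]
          have e : ∀ N N' : Fin ℓ → Fin (n + 1) → ℕ,
              ((∑ i, ∑ j, (N i j + if j = s i then ∑ j', N' i j' else 0) * (j : ℕ) : ℕ) : ℤ) =
                ∑ i, ∑ j, (N i j : ℤ) * j + ∑ i, ∑ j, (N' i j : ℤ) * s i := by
            intro N N'
            push_cast
            simp [add_mul, Finset.sum_add_distrib, Finset.sum_mul]
          have := e N N'
          have := e N' N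
          simp only [sub_mul, mul_sub, Finset.sum_sub_distrib] at hsum
          zify
          push_cast at *
          linarith)
      rw [expand N N' hN, expand N' N hN'] at hrel
      have hne : ∏ i, y i (s i) ^ (∑ j, N i j + ∑ j, N' i j) ≠ 0 :=
        Finset.prod_ne_zero_iff.2 fun i _ => pow_ne_zero _ (hy _ _ (hs i))
      simp only [add_comm (∑ j, N' _ j)] at hrel
      have hrel := mul_right_cancel₀ hne hrel
      have hrel' : ∏ i, ∏ j, x (i, j) ^ N i j = ∏ i, ∏ j, x (i, j) ^ N' i j :=
        Units.ext (by simpa using hrel)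
      rw [← div_eq_one] at hrel'
      rw [← hrel', Fintype.prod_prod_type, ← Finset.prod_div_distrib]
      refine Finset.prod_congr rfl fun i _ => ?_
      rw [← Finset.prod_div_distrib]
      refine Finset.prod_congr rfl fun j _ => ?_
      by_cases hD : D i j
      · rw [← hdiff i j hD, zpow_sub, zpow_natCast, zpow_natCast, div_eq_mul_inv]
      · simp [hx1 (i, j) hD])
  refine ⟨z, fun i j hD => ?_⟩
  have h1 := hxD (i, j) hD
  rw [hz (i, j)] at h1
  simpa [hD] using h1

end GIT

/-! ### The numerical criterion for semistability and stability. -/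

namespace GIT

variable {A B : Type*} [AddCommGroup A] [Module ℂ A] [AddCommGroup B] [Module ℂ B] {ℓ : ℕ}
variable {ρA : Representation ℂ ℂˣ A} {ρB : Representation ℂ ℂˣ B} {n u q : ℕ}
  {pr : Fin (n + 1) → B →ₗ[ℂ] B}

/-- If the numerical criterion holds strictly, then a semistable point of the orbit closure lies
in the orbit. -/
theorem IsWeightAction.inOrbit_of_inOrbitClosure (H : IsWeightAction ρA ρB u q pr) {a b : ℕ}
    (ha : 0 < a) {α α' : A} {β β' : Fin ℓ → B} {s r : Fin ℓ → Fin (n + 1)}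
    (hs : ∀ i, pr (s i) (β i) ≠ 0) (hr : ∀ i, pr (r i) (β i) ≠ 0)
    (hle : ∀ i j, pr j (β i) ≠ 0 → s i ≤ j ∧ j ≤ r i)
    (h1 : b * q * ∑ i, (s i : ℕ) < u * (a + b * ℓ)) (h2 : u * (a + b * ℓ) < b * q * ∑ i, (r i : ℕ))
    (hss : IsSemistable ρA ρB a b α' β') (hc : InOrbitClosure ρA ρB α β α' β') :
    InOrbit ρA ρB α β α' β' := by
  classical
  obtain ⟨c, rfl⟩ := H.exists_smul_of_inOrbitClosure_left hc
  have hc0 : c ≠ 0 := by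
    rintro rfl
    exact hss.ne_zero ha (zero_smul _ _)
  choose y hy using fun i j => H.exists_smul_of_inOrbitClosure hc i j
  choose F hF using fun (i : Fin ℓ) (j : Fin (n + 1)) => exists_functional (pr j (β i))
  have hFy : ∀ i j, pr j (β i) ≠ 0 → F i j (pr j (β' i)) = y i j := fun i j h => by
    rw [hy, map_smul, hF i j h, smul_eq_mul, mul_one]
  have rel : ∀ m m' : Fin ℓ → Fin (n + 1) → ℕ, (∀ i j, m i j ≠ 0 → pr j (β i) ≠ 0) →
      (∀ i j, m' i j ≠ 0 → pr j (β i) ≠ 0) → (∀ i, ∑ j, m i j = ∑ j, m' i j) →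
      ∑ i, ∑ j, m i j * (j : ℕ) = ∑ i, ∑ j, m' i j * (j : ℕ) →
      ∏ i, ∏ j, y i j ^ m i j = ∏ i, ∏ j, y i j ^ m' i j := by
    intro m m' hm hm' hrow hw
    have e1 : ∀ m : Fin ℓ → Fin (n + 1) → ℕ, (∀ i j, m i j ≠ 0 → pr j (β i) ≠ 0) →
        ∏ i, ∏ j, F i j (pr j (β' i)) ^ m i j = ∏ i, ∏ j, y i j ^ m i j := fun m hm =>
      Finset.prod_congr rfl fun i _ => Finset.prod_congr rfl fun j _ => by
        by_cases h0 : m i j = 0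
        · simp [h0]
        · rw [hFy i j (hm i j h0)]
    have e2 : ∀ m : Fin ℓ → Fin (n + 1) → ℕ, (∀ i j, m i j ≠ 0 → pr j (β i) ≠ 0) →
        ∏ i, ∏ j, F i j (pr j (β i)) ^ m i j = 1 := fun m hm =>
      Finset.prod_eq_one fun i _ => Finset.prod_eq_one fun j _ => by
        by_cases h0 : m i j = 0
        · simp [h0]
        · rw [hF i j (hm i j h0), one_pow]
    rw [← e1 m hm, ← e1 m' hm']
    exact H.monomial_eq_of_inOrbitClosure hc F hrow hw (by rw [e2 m hm, e2 m' hm'])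
  -- Semistability of the limit gives an invariant monomial `m₁` not vanishing there, and the strict
  -- inequalities give one, `m₂`, involving both extreme coordinates of every factor. Suitable
  -- powers have equal multidegree and weight, hence equal values, so the extreme coordinates of the
  -- limit are nonzero.
  have hext : ∀ i, y i (s i) ≠ 0 ∧ y i (r i) ≠ 0 := by
    obtain ⟨m, hm, ρ, hρ, hρw⟩ := H.exists_weights hss
    obtain ⟨M, hM, m₂, hrow, hw, hsupp, hpos⟩ := exists_exponents H.pos h1.le h2.le
    let m₁ : Fin ℓ → Fin (n + 1) → ℕ := fun i j => ∑ k, if ρ i k = j then 1 else 0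
    have hm₁ : ∀ i j, m₁ i j ≠ 0 → pr j (β' i) ≠ 0 := fun i j h => by
      obtain ⟨k, -, hk⟩ := Finset.exists_ne_zero_of_sum_ne_zero h
      have : ρ i k = j := by by_contra h'; simp [h'] at hk
      exact this ▸ hρ i k
    have hm₁' : ∀ i j, m₁ i j ≠ 0 → y i j ≠ 0 ∧ pr j (β i) ≠ 0 := fun i j h => by
      have := hm₁ i j h
      rw [hy] at this
      exact smul_ne_zero_iff.1 this
    have hrow₁ : ∀ i, ∑ j, m₁ i j = m * b := fun i => by
      rw [Finset.sum_comm]; simp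
    have hw₁ : ∀ i, ∑ j, m₁ i j * (j : ℕ) = ∑ k, (ρ i k : ℕ) := fun i => by
      simp only [m₁, Finset.sum_mul]
      rw [Finset.sum_comm]; simp
    have key := rel (fun i j => M * m₁ i j) (fun i j => m * m₂ i j)
      (fun i j h => (hm₁' i j (right_ne_zero_of_mul h)).2)
      (fun i j h => by
        rcases hsupp i j (right_ne_zero_of_mul h) with rfl | rfl
        exacts [hs i, hr i])
      (fun i => by rw [← Finset.mul_sum, ← Finset.mul_sum, hrow₁, hrow]; ring)
      (by
        apply Nat.eq_of_mul_eq_mul_left H.pos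
        simp only [mul_assoc, ← Finset.mul_sum, hw₁]
        rw [mul_left_comm, hρw, mul_left_comm q, hw]
        ring)
    have hne : ∏ i, ∏ j, y i j ^ (m * m₂ i j) ≠ 0 := by
      rw [← key]
      refine Finset.prod_ne_zero_iff.2 fun i _ => Finset.prod_ne_zero_iff.2 fun j _ => ?_
      by_cases h0 : m₁ i j = 0
      · simp [h0]
      · exact pow_ne_zero _ (hm₁' i j h0).1
    have hne' : ∀ i j, m₂ i j ≠ 0 → y i j ≠ 0 := fun i j h =>
      ne_zero_pow (mul_ne_zero hm.ne' h)
        (Finset.prod_ne_zero_iff.1 (Finset.prod_ne_zero_iff.1 hne i (Finset.mem_univ _)) j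
          (Finset.mem_univ _))
    exact fun i => ⟨hne' i _ (hpos h1 h2 i).1, hne' i _ (hpos h1 h2 i).2⟩
  have hyne : ∀ i j, pr j (β i) ≠ 0 → y i j ≠ 0 := by
    intro i j hj
    rcases eq_or_ne j (s i) with rfl | hjs
    · exact (hext i).1
    obtain ⟨hsj, hjr⟩ := hle i j hj
    have hlt : (s i : ℕ) < j := lt_of_le_of_ne hsj fun h => hjs (Fin.ext h.symm)
    have hjr' : (j : ℕ) ≤ r i := hjr
    have hsum : ∀ f : Fin ℓ → Fin (n + 1) → ℕ, (∀ i' j', i' ≠ i → f i' j' = 0) →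
        ∑ i', ∑ j', f i' j' = ∑ j', f i j' := fun f hf =>
      Finset.sum_eq_single i (fun i' _ h => Finset.sum_eq_zero fun j' _ => hf i' j' h) (by simp)
    -- The relation `y_j^(r-s) = y_s^(r-j) · y_r^(j-s)` within one factor carries nonvanishing from
    -- the two ends to every coordinate in between.
    have key := rel (fun i' j' => if i' = i then if j' = j then (r i : ℕ) - s i else 0 else 0)
      (fun i' j' => if i' = i then (if j' = s i then (r i : ℕ) - j else 0) +
        (if j' = r i then (j : ℕ) - s i else 0) else 0)
      (fun i' j' h => by
        by_cases hi : i' = i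
        · subst hi
          by_cases hj' : j' = j
          · exact hj' ▸ hj
          · simp [hj'] at h
        · simp [hi] at h)
      (fun i' j' h => by
        by_cases hi : i' = i
        · subst hi
          by_cases hj' : j' = s i'
          · exact hj' ▸ hs i'
          · by_cases hj'' : j' = r i'
            · exact hj'' ▸ hr i'
            · simp [hj', hj''] at h
        · simp [hi] at h)
      (fun i' => by
        by_cases hi : i' = i
        · subst hi
          simp [Finset.sum_add_distrib]
          omega
        · simp [hi])
      (by
        rw [hsum _ (fun i' j' h => by simp [h]), hsum _ (fun i' j' h => by simp [h])]
        simp [add_mul, Finset.sum_add_distrib]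
        zify [hsj.trans hjr, hlt.le, hjr', show (s i : ℕ) ≤ r i from hsj.trans hjr]
        ring)
    have hne : ∏ i', ∏ j', y i' j' ^ (if i' = i then (if j' = s i then (r i : ℕ) - j else 0) +
        (if j' = r i then (j : ℕ) - s i else 0) else 0) ≠ 0 := by
      refine Finset.prod_ne_zero_iff.2 fun i' _ => Finset.prod_ne_zero_iff.2 fun j' _ => ?_
      by_cases hi : i' = i
      · subst hi
        by_cases hj' : j' = s i'
        · exact pow_ne_zero _ (hj' ▸ (hext i').1)
        · by_cases hj'' : j' = r i'
          · exact pow_ne_zero _ (hj'' ▸ (hext i').2)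
          · simp [hj', hj'']
      · simp [hi]
    rw [← key] at hne
    have := Finset.prod_ne_zero_iff.1 (Finset.prod_ne_zero_iff.1 hne i (Finset.mem_univ _)) j
      (Finset.mem_univ _)
    simp only [if_true] at this
    exact ne_zero_pow (by omega) this
  obtain ⟨z, hz⟩ := exists_parameter (fun i j => pr j (β i) ≠ 0) y s hs hyne rel
  obtain ⟨t₀, ht₀⟩ := IsAlgClosed.exists_pow_nat_eq (z : ℂ) H.pos
  have ht₀' : t₀ ≠ 0 := by
    rintro rfl
    rw [zero_pow H.pos.ne'] at ht₀
    exact z.ne_zero ht₀.symm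
  let t : ℂˣ := Units.mk0 t₀ ht₀'
  have ht : t ^ q = z := Units.ext (by simpa [t] using ht₀)
  -- Since `t^q = z`, component `j` of `β_i` is multiplied by `t^(-u) z^j`, whereas the limit
  -- requires `z^(j - s_i) y_{i,s_i}`; the scalars make up the difference.
  refine ⟨t, Units.mk0 c hc0 * t ^ (u : ℤ),
    fun i => Units.mk0 _ (hext i).1 * z ^ (-(s i : ℤ)) * t ^ (u : ℤ), ?_, fun i => ?_⟩
  · rw [H.actA, smul_smul, ← Units.val_mul, mul_assoc, ← zpow_add]
    simp
  · rw [H.actB, smul_smul, ← Units.val_mul, mul_assoc, ← zpow_add, Finset.smul_sum]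
    conv_lhs => rw [← H.sum_proj (β' i)]
    refine Finset.sum_congr rfl fun j _ => ?_
    rw [hy i j, smul_smul]
    by_cases hj : pr j (β i) = 0
    · simp [hj]
    · congr 1
      rw [hz i j hj, pow_mul, ← Units.val_pow_eq_pow_val, ht, add_neg_cancel, zpow_zero, mul_one,
        sub_eq_add_neg, zpow_add, zpow_natCast]
      simp only [Units.val_mul, Units.val_mk0, Units.val_pow_eq_pow_val]
      ring

/-- The numerical criterion for semistability. -/
theorem IsWeightAction.isSemistable_iff (H : IsWeightAction ρA ρB u q pr) {a b : ℕ}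
    {α : A} (hα : α ≠ 0) {β : Fin ℓ → B} {s r : Fin ℓ → Fin (n + 1)}
    (hs : ∀ i, pr (s i) (β i) ≠ 0) (hr : ∀ i, pr (r i) (β i) ≠ 0)
    (hle : ∀ i j, pr j (β i) ≠ 0 → s i ≤ j ∧ j ≤ r i) :
    IsSemistable ρA ρB a b α β ↔
      b * q * ∑ i, (s i : ℕ) ≤ u * (a + b * ℓ) ∧ u * (a + b * ℓ) ≤ b * q * ∑ i, (r i : ℕ) := by
  constructor
  · intro h
    obtain ⟨m, hm, ρ, hρ, hρw⟩ := H.exists_weights h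
    have h1 : ∑ i, m * b * (s i : ℕ) ≤ ∑ i, ∑ k, (ρ i k : ℕ) :=
      Finset.sum_le_sum fun i _ => by
        have := Finset.card_nsmul_le_sum Finset.univ (fun k => (ρ i k : ℕ)) (s i)
          fun k _ => (hle i _ (hρ i k)).1
        simpa using this
    have h2 : ∑ i, ∑ k, (ρ i k : ℕ) ≤ ∑ i, m * b * (r i : ℕ) :=
      Finset.sum_le_sum fun i _ => by
        have := Finset.sum_le_card_nsmul Finset.univ (fun k => (ρ i k : ℕ)) (r i)
          fun k _ => (hle i _ (hρ i k)).2
        simpa using this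
    rw [← Finset.mul_sum] at h1 h2
    constructor
    · refine Nat.le_of_mul_le_mul_left ?_ hm
      nlinarith [Nat.mul_le_mul_left q h1]
    · refine Nat.le_of_mul_le_mul_left ?_ hm
      nlinarith [Nat.mul_le_mul_left q h2]
  · rintro ⟨h1, h2⟩
    obtain ⟨M, hM, m, hrow, hw, hsupp, -⟩ := exists_exponents H.pos h1 h2
    refine H.isSemistable_of_exponents hα hM m hrow (by rw [hw]; ring) fun i j h => ?_
    rcases hsupp i j h with rfl | rfl
    exacts [hs i, hr i]

theorem infinite_complex_units : Infinite ℂˣ :=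
  Infinite.of_injective (fun k : ℕ => Units.mk0 ((k : ℂ) + 1) (Nat.cast_add_one_ne_zero k))
    fun a b h => by simpa using congrArg Units.val h

/-- The limit of `t • β` with weights `e i` lies in the orbit closure, so a point for which it is
semistable is not stable. -/
theorem IsWeightAction.not_isStable_of_extreme (H : IsWeightAction ρA ρB u q pr) {a b : ℕ}
    {α : A} (hα : α ≠ 0) {β : Fin ℓ → B} {e : Fin ℓ → Fin (n + 1)}
    (he : ∀ i, pr (e i) (β i) ≠ 0)
    (hext : (∀ i j, pr j (β i) ≠ 0 → e i ≤ j) ∨ (∀ i j, pr j (β i) ≠ 0 → j ≤ e i))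
    (heq : b * q * ∑ i, (e i : ℕ) = u * (a + b * ℓ)) : ¬ IsStable ρA ρB a b α β := by
  classical
  rintro ⟨-, hclosed, hfin⟩
  have horb := hclosed α (fun i => pr (e i) (β i))
    (H.isSemistable_of_exponents hα one_pos (fun i j => if j = e i then b else 0)
      (by simp) (by simp [← heq, ← Finset.mul_sum]; ring)
      (fun i j h => by
        have : j = e i := by by_contra h'; simp [h'] at h
        simp [H.proj, this, he i]))
    (fun a' b' T hT => by
      -- A form vanishing on the orbit has vanishing coefficient in each weight. In the extreme
      -- weight the only nonzero term can be `r x = e x.1`, and that term is the value of the form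
      -- at the limit.
      have key := sum_coeff_of_forall_units
        (fun r : (Σ i : Fin ℓ, Fin (b' i)) → Fin (n + 1) =>
          T (fun _ => α) (fun x => pr (r x) (β x.1)))
        (fun r => q * ∑ x, (r x : ℕ)) 0 0 (fun t => by
          have h1 := hT t
          rw [H.eval_act T α β t] at h1
          have h2 := (mul_eq_zero.1 h1).resolve_left (pow_ne_zero _ (Units.ne_zero _))
          rw [h2, zero_mul]) (q * ∑ x : (Σ i : Fin ℓ, Fin (b' i)), (e x.1 : ℕ))
      simp only [ite_self] at key
      rw [Finset.sum_eq_single (fun x => e x.1), if_pos rfl] at key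
      · exact key
      · intro r _ hr
        by_contra hne
        rw [ite_eq_right_iff, Classical.not_imp] at hne
        obtain ⟨hsum, hT0⟩ := hne
        have hr0 : ∀ x, pr (r x) (β x.1) ≠ 0 := fun x h0 =>
          hT0 (MultilinearMap.map_coord_zero _ x h0)
        have hsum := Nat.eq_of_mul_eq_mul_left H.pos hsum
        refine hr (funext fun x => Fin.ext ?_)
        rcases hext with h | h
        · exact ((Finset.sum_eq_sum_iff_of_le fun x _ => Fin.le_def.1 (h x.1 _ (hr0 x))).1 hsum.symm
            x (Finset.mem_univ _)).symm
        · exact (Finset.sum_eq_sum_iff_of_le fun x _ => Fin.le_def.1 (h x.1 _ (hr0 x))).1 hsum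
            x (Finset.mem_univ _)
      · simp)
  -- If the limit lies in the orbit, each `β i` already has a single component, so all of `ℂ*` fixes
  -- the point.
  obtain ⟨t, -, d, -, hd⟩ := horb
  have hzero : ∀ i j, j ≠ e i → pr j (β i) = 0 := fun i j hj => by
    have h := congrArg (pr j) (hd i)
    rw [H.proj, if_neg hj, map_smul, H.proj_act, smul_smul] at h
    refine (smul_eq_zero.1 h.symm).resolve_left ?_
    exact mul_ne_zero (Units.ne_zero _) (mul_ne_zero (Units.ne_zero _)
      (pow_ne_zero _ (Units.ne_zero _)))
  refine @Set.infinite_univ ℂˣ infinite_complex_units (hfin.subset fun t _ => ?_)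
  refine ⟨t ^ (-(u : ℤ)), fun i => t ^ (-(u : ℤ)) * t ^ (q * (e i : ℕ)), H.actA t α, fun i => ?_⟩
  rw [H.actB, Finset.sum_eq_single (e i) (fun j _ hj => by rw [hzero i j hj, smul_zero]) (by simp),
    smul_smul]
  have : pr (e i) (β i) = β i := by
    conv_rhs => rw [← H.sum_proj (β i)]
    rw [Finset.sum_eq_single (e i) (fun j _ hj => hzero i j hj) (by simp)]
  rw [this]
  simp

/-- The numerical criterion for stability. -/
theorem IsWeightAction.isStable_iff (H : IsWeightAction ρA ρB u q pr) {a b : ℕ} (ha : 0 < a)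
    {α : A} (hα : α ≠ 0) {β : Fin ℓ → B} {s r : Fin ℓ → Fin (n + 1)}
    (hs : ∀ i, pr (s i) (β i) ≠ 0) (hr : ∀ i, pr (r i) (β i) ≠ 0)
    (hle : ∀ i j, pr j (β i) ≠ 0 → s i ≤ j ∧ j ≤ r i) :
    IsStable ρA ρB a b α β ↔
      b * q * ∑ i, (s i : ℕ) < u * (a + b * ℓ) ∧ u * (a + b * ℓ) < b * q * ∑ i, (r i : ℕ) := by
  constructor
  · intro h
    obtain ⟨h1, h2⟩ := (H.isSemistable_iff hα hs hr hle).1 h.1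
    refine ⟨h1.lt_of_ne fun heq => ?_, h2.lt_of_ne fun heq => ?_⟩
    · exact H.not_isStable_of_extreme hα hs (Or.inl fun i j hj => (hle i j hj).1) heq h
    · exact H.not_isStable_of_extreme hα hr (Or.inr fun i j hj => (hle i j hj).2) heq.symm h
  · rintro ⟨h1, h2⟩
    refine ⟨(H.isSemistable_iff hα hs hr hle).2 ⟨h1.le, h2.le⟩, fun α' β' hss hc =>
      H.inOrbit_of_inOrbitClosure ha hs hr hle h1 h2 hss hc, ?_⟩
    -- Some `β i` has two distinct weights `s i < r i`; a stabilizing `t` acts on both components by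
    -- the same scalar, so `t^(q(r i - s i)) = 1`.
    obtain ⟨i, -, hi⟩ := Finset.exists_lt_of_sum_lt (Nat.lt_of_mul_lt_mul_left (h1.trans h2))
    have hpos : 0 < q * (r i : ℕ) - q * (s i : ℕ) := by
      have := Nat.mul_lt_mul_of_pos_left hi H.pos
      omega
    have : NeZero (q * (r i : ℕ) - q * (s i : ℕ)) := ⟨hpos.ne'⟩
    refine Set.Finite.subset (s := (rootsOfUnity (q * (r i : ℕ) - q * (s i : ℕ)) ℂ : Set ℂˣ))
      (@Set.toFinite _ _ (inferInstanceAs (Finite (rootsOfUnity _ ℂ)))) ?_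
    rintro t ⟨-, d, -, hd⟩
    have hval : ∀ j, pr j (β i) ≠ 0 →
        t ^ (-(u : ℤ)) * t ^ (q * (j : ℕ)) = d i := fun j hj => by
      have h := congrArg (pr j) (hd i)
      rw [H.proj_act, map_smul] at h
      have := smul_left_injective ℂ hj h
      exact Units.ext (by simpa using this)
    have := mul_left_cancel ((hval _ (hr i)).trans (hval _ (hs i)).symm)
    rw [SetLike.mem_coe, mem_rootsOfUnity]
    rw [← Nat.sub_add_cancel (show q * (s i : ℕ) ≤ q * (r i : ℕ) by omega), pow_add] at this
    exact mul_eq_right.1 this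

end GIT

/-! ### The weight decomposition of an exterior power -/

section WeightProjections

variable {M : Type*} [AddCommGroup M] [Module ℂ M]

/-- The matrix of Lagrange interpolation at `0, …, n`. -/
def interpolationMatrix (n : ℕ) : Matrix (Fin (n + 1)) (Fin (n + 1)) ℂ :=
  (Matrix.vandermonde fun k : Fin (n + 1) => (k : ℂ))⁻¹

theorem sum_interpolationMatrix (n : ℕ) (j : Fin (n + 1)) (i : ℕ) (hi : i ≤ n) :
    ∑ k : Fin (n + 1), interpolationMatrix n j k * (k : ℂ) ^ i = if i = j then 1 else 0 := by
  have hdet : IsUnit (Matrix.vandermonde fun k : Fin (n + 1) => (k : ℂ)).det := by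
    rw [isUnit_iff_ne_zero, Matrix.det_vandermonde_ne_zero_iff]
    exact fun a b h => Fin.ext (Nat.cast_injective (R := ℂ) h)
  have h := congrFun (congrFun (Matrix.nonsing_inv_mul _ hdet) j) ⟨i, Nat.lt_succ_of_le hi⟩
  rw [Matrix.mul_apply, Matrix.one_apply] at h
  simp only [Matrix.vandermonde_apply] at h
  rw [interpolationMatrix, h]
  simp [Fin.ext_iff, eq_comm]

/-- The projection of `⋀ⁿ M` onto the part of degree `j` in the range of the idempotent `e`. -/
def weightProj (n : ℕ) (e : M →ₗ[ℂ] M) (j : Fin (n + 1)) : ⋀[ℂ]^n M →ₗ[ℂ] ⋀[ℂ]^n M :=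
  ∑ k : Fin (n + 1), interpolationMatrix n j k •
    exteriorPower.map n ((LinearMap.id - e) + (k : ℂ) • e)

theorem map_scaling_ιMulti (n : ℕ) (e : M →ₗ[ℂ] M) (z : ℂ) (b : Fin n → M) :
    exteriorPower.map n ((LinearMap.id - e) + z • e) (exteriorPower.ιMulti ℂ n b) =
      ∑ A : Finset (Fin n), z ^ A.card •
        exteriorPower.ιMulti ℂ n (A.piecewise (fun i => e (b i)) fun i => b i - e (b i)) := by
  rw [exteriorPower.map_apply_ιMulti]
  have h : (((LinearMap.id - e) + z • e : M →ₗ[ℂ] M) ∘ b) =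
      (fun i => z • e (b i)) + fun i => b i - e (b i) := by
    funext i
    simp [add_comm]
  rw [h]
  have h2 := (exteriorPower.ιMulti ℂ n (M := M)).toMultilinearMap.map_add_univ
    (fun i => z • e (b i)) (fun i => b i - e (b i))
  simp only [AlternatingMap.coe_multilinearMap] at h2
  rw [h2]
  refine Finset.sum_congr rfl fun A _ => ?_
  have h3 := (exteriorPower.ιMulti ℂ n (M := M)).toMultilinearMap.map_piecewise_smul
    (fun _ => z) (A.piecewise (fun i => e (b i)) fun i => b i - e (b i)) A
  simp only [AlternatingMap.coe_multilinearMap, Finset.prod_const] at h3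
  rw [← h3]
  congr 1
  funext i
  by_cases hi : i ∈ A <;> simp [hi]

/-- Interpolation extracts the coefficient of `z^j` from `map_scaling_ιMulti`. Projections built
this way need neither a basis nor finite dimension of `M`. -/
theorem weightProj_ιMulti (n : ℕ) (e : M →ₗ[ℂ] M) (j : Fin (n + 1)) (b : Fin n → M) :
    weightProj n e j (exteriorPower.ιMulti ℂ n b) =
      ∑ A : Finset (Fin n), if A.card = j then
        exteriorPower.ιMulti ℂ n (A.piecewise (fun i => e (b i)) fun i => b i - e (b i)) else 0 := by
  simp only [weightProj, LinearMap.sum_apply, LinearMap.smul_apply, map_scaling_ιMulti,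
    Finset.smul_sum, smul_smul]
  rw [Finset.sum_comm]
  refine Finset.sum_congr rfl fun A _ => ?_
  rw [← Finset.sum_smul, sum_interpolationMatrix n j A.card (by simpa using A.card_le_univ)]
  split_ifs <;> simp

theorem map_scaling (n : ℕ) (e : M →ₗ[ℂ] M) (z : ℂ) (x : ⋀[ℂ]^n M) :
    exteriorPower.map n ((LinearMap.id - e) + z • e) x =
      ∑ j : Fin (n + 1), z ^ (j : ℕ) • weightProj n e j x := by
  have h : exteriorPower.map n ((LinearMap.id - e) + z • e) =
      ∑ j : Fin (n + 1), z ^ (j : ℕ) • weightProj n e j := by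
    refine exteriorPower.linearMap_ext (AlternatingMap.ext fun b => ?_)
    simp only [LinearMap.compAlternatingMap_apply, map_scaling_ιMulti, LinearMap.sum_apply,
      LinearMap.smul_apply, weightProj_ιMulti, Finset.smul_sum]
    rw [Finset.sum_comm]
    refine Finset.sum_congr rfl fun A _ => ?_
    rw [Finset.sum_eq_single ⟨A.card, Nat.lt_succ_of_le (by simpa using A.card_le_univ)⟩]
    · simp
    · intro j _ hj
      rw [if_neg (fun h => hj (Fin.ext h.symm)), smul_zero]
    · simp
  rw [h]
  simp

/-- Expanding a pure wedge whose slots already lie in the range or kernel of `e`, any other choice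
of subset puts a zero into some slot. -/
theorem weightProj_weightProj (n : ℕ) {e : M →ₗ[ℂ] M} (he : ∀ x, e (e x) = e x)
    (i j : Fin (n + 1)) (x : ⋀[ℂ]^n M) :
    weightProj n e i (weightProj n e j x) = if i = j then weightProj n e j x else 0 := by
  have h : weightProj n e i ∘ₗ weightProj n e j = if i = j then weightProj n e j else 0 := by
    refine exteriorPower.linearMap_ext (AlternatingMap.ext fun b => ?_)
    have key : ∀ A : Finset (Fin n), weightProj n e i (exteriorPower.ιMulti ℂ n
        (A.piecewise (fun i => e (b i)) fun i => b i - e (b i))) = if A.card = i then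
        exteriorPower.ιMulti ℂ n (A.piecewise (fun i => e (b i)) fun i => b i - e (b i)) else 0 := by
      intro A
      rw [weightProj_ιMulti, Finset.sum_eq_single A]
      · congr 2
        funext k
        by_cases hk : k ∈ A <;> simp [hk, he]
      · intro A' _ hA'
        have : ∃ k, ¬ (k ∈ A' ↔ k ∈ A) := by
          by_contra! h'
          exact hA' (Finset.ext h')
        obtain ⟨k, hk⟩ := this
        rw [AlternatingMap.map_coord_zero _ k, ite_self]
        by_cases h1 : k ∈ A <;> by_cases h2 : k ∈ A' <;> simp_all
      · simp
    simp only [LinearMap.compAlternatingMap_apply, LinearMap.comp_apply, weightProj_ιMulti, map_sum,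
      apply_ite (weightProj n e i), key, map_zero]
    by_cases hij : i = j
    · subst hij
      simp only [if_true, weightProj_ιMulti]
      exact Finset.sum_congr rfl fun A _ => by split_ifs <;> rfl
    · simp only [if_neg hij]
      refine Finset.sum_eq_zero fun A _ => ?_
      split_ifs with h1 h2
      · exact absurd (Fin.ext (h2.symm.trans h1)) hij
      all_goals rfl
  have := congrArg (fun f => f x) h
  split_ifs at this ⊢ <;> simpa using this

/-- If fewer than `|I|` slots take the `e`-part, some slot in `I` takes `b i - e (b i) = 0`. -/
theorem weightProj_ιMulti_eq_zero_of_lt {n : ℕ} {e : M →ₗ[ℂ] M} {b : Fin n → M} {I : Finset (Fin n)}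
    (hI : ∀ i ∈ I, e (b i) = b i) {j : Fin (n + 1)} (hj : (j : ℕ) < I.card) :
    weightProj n e j (exteriorPower.ιMulti ℂ n b) = 0 := by
  rw [weightProj_ιMulti]
  refine Finset.sum_eq_zero fun A _ => ?_
  split_ifs with hA
  · obtain ⟨i, hiI, hiA⟩ : ∃ i ∈ I, i ∉ A := by
      by_contra! h
      have := Finset.card_le_card h
      omega
    exact AlternatingMap.map_coord_zero _ i (by simp [hiA, hI i hiI])
  · rfl

/-- A subset with more than `n - |I|` elements meets `I`, and there the `e`-part is zero. -/
theorem weightProj_ιMulti_eq_zero_of_gt {n : ℕ} {e : M →ₗ[ℂ] M} {b : Fin n → M} {I : Finset (Fin n)}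
    (hI : ∀ i ∈ I, e (b i) = 0) {j : Fin (n + 1)} (hj : n - I.card < (j : ℕ)) :
    weightProj n e j (exteriorPower.ιMulti ℂ n b) = 0 := by
  rw [weightProj_ιMulti]
  refine Finset.sum_eq_zero fun A _ => ?_
  split_ifs with hA
  · obtain ⟨i, hiI, hiA⟩ : ∃ i ∈ I, i ∈ A := by
      by_contra! h
      have h1 := Finset.card_le_univ (I ∪ A)
      rw [Finset.card_union_of_disjoint (Finset.disjoint_left.2 h)] at h1
      simp only [Fintype.card_fin] at h1
      omega
    exact AlternatingMap.map_coord_zero _ i (by simp [hiA, hI i hiI])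
  · rfl

theorem Submodule.exists_basis_of_finrank_eq {K : Type*} [AddCommGroup K] [Module ℂ K]
    [FiniteDimensional ℂ K] {n : ℕ} (hn : Module.finrank ℂ K = n) (K' : Submodule ℂ K) :
    ∃ (b : Module.Basis (Fin n) ℂ K) (I : Finset (Fin n)),
      I.card = Module.finrank ℂ K' ∧ ∀ i ∈ I, b i ∈ K' := by
  obtain ⟨Q, hQ⟩ := K'.exists_isCompl
  let b₀ := ((Module.finBasis ℂ K').prod (Module.finBasis ℂ Q)).map
    (K'.prodEquivOfIsCompl Q hQ)
  let σ : Fin (Module.finrank ℂ K') ⊕ Fin (Module.finrank ℂ Q) ≃ Fin n :=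
    Fintype.equivOfCardEq (by rw [← Module.finrank_eq_card_basis b₀, hn, Fintype.card_fin])
  refine ⟨b₀.reindex σ, Finset.univ.map (Function.Embedding.inl.trans σ.toEmbedding), by simp, ?_⟩
  intro i hi
  obtain ⟨k, -, rfl⟩ := Finset.mem_map.1 hi
  simp [b₀]

/-- An alternating map on a space of dimension `n` vanishes if it vanishes on all bases adapted
to a given subspace. -/
theorem alternatingMap_eq_zero_of_adapted {N : Type*} [AddCommGroup N] [Module ℂ N] {n : ℕ}
    {S : Submodule ℂ M} (bS : Module.Basis (Fin n) ℂ S) (S' : Submodule ℂ M)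
    (f : M [⋀^Fin n]→ₗ[ℂ] N)
    (hf : ∀ (c : Fin n → M) (I : Finset (Fin n)),
      I.card = Module.finrank ℂ (S ⊓ S' : Submodule ℂ M) → (∀ i ∈ I, c i ∈ S') → f c = 0) :
    f (fun i => (bS i : M)) = 0 := by
  have : FiniteDimensional ℂ S := Module.Finite.of_basis bS
  obtain ⟨b, I, hI, hb⟩ := Submodule.exists_basis_of_finrank_eq
    (by rw [Module.finrank_eq_card_basis bS, Fintype.card_fin]) (S'.comap S.subtype)
  have h0 : f.compLinearMap S.subtype = 0 := by
    refine Module.Basis.ext_alternating b fun v hv => ?_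
    -- `Basis.ext_alternating` tests all injective index maps, that is, permutations of the adapted
    -- basis; the set `I` is transported by the inverse permutation.
    let σ : Equiv.Perm (Fin n) := Equiv.ofBijective v (Finite.injective_iff_bijective.1 hv)
    refine hf _ (I.map σ.symm.toEmbedding) ?_ ?_
    · rw [Finset.card_map, hI]
      have e := (Submodule.equivMapOfInjective S.subtype S.injective_subtype
        (S'.comap S.subtype)).finrank_eq
      rw [e, Submodule.map_comap_subtype]
    · intro i hi
      obtain ⟨k, hk, rfl⟩ := Finset.mem_map.1 hi
      have : v (σ.symm k) = k := σ.apply_symm_apply k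
      simp only [Equiv.coe_toEmbedding, this]
      exact hb k hk
  exact congrArg (fun g => g bS) h0

/-- Coordinates of `b₁ ∧ ⋯ ∧ bₙ` given by determinants detect its weight components. -/
theorem weightProj_ne_zero_of_det {N : Type*} [AddCommGroup N] [Module ℂ N] {n : ℕ}
    {e : Module.Dual ℂ N →ₗ[ℂ] Module.Dual ℂ N} {b : Fin n → Module.Dual ℂ N} {z : Fin n → N}
    {I : Finset (Fin n)} (he : ∀ φ k, e φ (z k) = if k ∈ I then φ (z k) else 0)
    (hdet : (Matrix.of fun i k => b i (z k)).det ≠ 0) {j : Fin (n + 1)} (hj : (j : ℕ) = I.card) :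
    weightProj n e j (exteriorPower.ιMulti ℂ n b) ≠ 0 := by
  let f : ⋀[ℂ]^n (Module.Dual ℂ N) →ₗ[ℂ] ℂ := exteriorPower.alternatingMapLinearEquiv
    (Matrix.detRowAlternating.compLinearMap
      (LinearMap.pi fun k => Module.Dual.eval ℂ N (z k) : Module.Dual ℂ N →ₗ[ℂ] Fin n → ℂ))
  have hf : ∀ c, f (exteriorPower.ιMulti ℂ n c) = (Matrix.of fun i k => c i (z k)).det := fun c => by
    rw [exteriorPower.alternatingMapLinearEquiv_apply_ιMulti]
    rfl
  -- Scaling by `t` on the range of `e` multiplies the columns in `I` by `t`, so this determinant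
  -- coordinate is homogeneous of degree `|I|` and only sees that weight component.
  have key := sum_coeff_of_forall_units
    (fun j => f (weightProj n e j (exteriorPower.ιMulti ℂ n b))) (fun j => (j : ℕ))
    (Matrix.of fun i k => b i (z k)).det I.card (fun t => by
      have h := congrArg f (map_scaling n e t (exteriorPower.ιMulti ℂ n b))
      rw [map_sum, exteriorPower.map_apply_ιMulti, hf] at h
      simp only [map_smul, smul_eq_mul] at h
      rw [← h]
      have h2 := Matrix.det_mul_row (fun k => if k ∈ I then (t : ℂ) else 1)
        (Matrix.of fun i k => b i (z k))
      rw [Finset.prod_ite_mem, Finset.univ_inter, Finset.prod_const] at h2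
      rw [mul_comm, ← h2]
      congr 1
      ext i k
      by_cases hk : k ∈ I <;> simp [he, hk]) I.card
  rw [if_pos rfl, Finset.sum_eq_single j, if_pos hj] at key
  · intro h0
    rw [h0, map_zero] at key
    exact hdet key.symm
  · intro i _ hi
    rw [if_neg fun h => hi (Fin.ext (h.trans hj.symm))]
  · simp

end WeightProjections

/-! ### Plücker vectors in a dual space -/

section Points

/-- Finitely many linear equations `L k = 0` are tested on `rank L` vectors. -/
theorem exists_test_vectors {K V : Type*} [AddCommGroup K] [Module ℂ K] [FiniteDimensional ℂ K]
    [AddCommGroup V] [Module ℂ V] (L : K →ₗ[ℂ] Module.Dual ℂ V) {r : ℕ}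
    (hr : Module.finrank ℂ (LinearMap.range L) = r) :
    ∃ x : Fin r → V, ∀ k, (∀ i, L k (x i) = 0) → L k = 0 := by
  let B : LinearMap.range L →ₗ[ℂ] V →ₗ[ℂ] ℂ := (LinearMap.range L).subtype
  -- The range of `L` is finite-dimensional and pairs faithfully with `V`, so `V` surjects onto its
  -- dual; lifts of a dual basis serve as test vectors.
  have hsurj : Function.Surjective B.flip :=
    LinearMap.flip_surjective_iff₁.2 (Submodule.injective_subtype _)
  let b := Module.finBasisOfFinrankEq ℂ (Module.Dual ℂ (LinearMap.range L))
    (Subspace.dual_finrank_eq.trans hr)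
  choose x hx using fun i => hsurj (b i)
  refine ⟨x, fun k hk => ?_⟩
  let w : LinearMap.range L := ⟨L k, LinearMap.mem_range_self L k⟩
  have h : Module.Dual.eval ℂ _ w = 0 := b.ext fun i => by
    rw [← hx i]
    exact hk i
  have h2 : w = 0 := (Module.forall_dual_apply_eq_zero_iff ℂ w).1 fun f =>
    LinearMap.congr_fun h f
  exact congrArg Subtype.val h2

/-- Restriction of `S` to `V₁` has kernel `S ⊓ ker i₁.dualMap`, and this kernel restricts
injectively to `V₂`; the two ranks are the numbers of test vectors needed. -/
theorem exists_separating_vectors {N V₁ V₂ : Type*} [AddCommGroup N] [Module ℂ N]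
    [AddCommGroup V₁] [Module ℂ V₁] [AddCommGroup V₂] [Module ℂ V₂] (i₁ : V₁ →ₗ[ℂ] N)
    (i₂ : V₂ →ₗ[ℂ] N) (hi : ∀ φ : Module.Dual ℂ N, φ ∘ₗ i₁ = 0 → φ ∘ₗ i₂ = 0 → φ = 0)
    {S : Submodule ℂ (Module.Dual ℂ N)} [FiniteDimensional ℂ S] :
    ∃ (x : Fin (Module.finrank ℂ S - Module.finrank ℂ
        (S ⊓ LinearMap.ker i₁.dualMap : Submodule ℂ (Module.Dual ℂ N))) → V₁)
      (y : Fin (Module.finrank ℂ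
        (S ⊓ LinearMap.ker i₁.dualMap : Submodule ℂ (Module.Dual ℂ N))) → V₂),
      ∀ φ ∈ S, (∀ i, φ (i₁ (x i)) = 0) → (∀ i, φ (i₂ (y i)) = 0) → φ = 0 := by
  let L₁ := i₁.dualMap ∘ₗ S.subtype
  let L₂ := i₂.dualMap ∘ₗ (S ⊓ LinearMap.ker i₁.dualMap).subtype
  have h₂ : Function.Injective L₂ := by
    rw [← LinearMap.ker_eq_bot, LinearMap.ker_eq_bot']
    exact fun φ hφ => Subtype.ext (hi φ φ.2.2 hφ)
  have hker : Module.finrank ℂ (LinearMap.ker L₁) =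
      Module.finrank ℂ (S ⊓ LinearMap.ker i₁.dualMap : Submodule ℂ (Module.Dual ℂ N)) := by
    rw [LinearMap.ker_comp, (Submodule.equivMapOfInjective S.subtype S.injective_subtype
      ((LinearMap.ker i₁.dualMap).comap S.subtype)).finrank_eq, Submodule.map_comap_subtype]
  have : FiniteDimensional ℂ (S ⊓ LinearMap.ker i₁.dualMap : Submodule ℂ (Module.Dual ℂ N)) :=
    Submodule.finiteDimensional_of_le inf_le_left
  obtain ⟨x, hx⟩ := exists_test_vectors L₁ (r := Module.finrank ℂ S - Module.finrank ℂ
    (S ⊓ LinearMap.ker i₁.dualMap : Submodule ℂ (Module.Dual ℂ N))) (by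
      rw [← hker, ← L₁.finrank_range_add_finrank_ker, Nat.add_sub_cancel])
  obtain ⟨y, hy⟩ := exists_test_vectors L₂ (LinearMap.finrank_range_of_inj h₂)
  refine ⟨x, y, fun φ hφ h1 h2 => ?_⟩
  have h1' : φ ∘ₗ i₁ = 0 := hx ⟨φ, hφ⟩ h1
  exact hi φ h1' (hy ⟨φ, hφ, h1'⟩ h2)

theorem exists_det_ne_zero {N V₁ V₂ : Type*} [AddCommGroup N] [Module ℂ N]
    [AddCommGroup V₁] [Module ℂ V₁] [AddCommGroup V₂] [Module ℂ V₂] (i₁ : V₁ →ₗ[ℂ] N)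
    (i₂ : V₂ →ₗ[ℂ] N) (hi : ∀ φ : Module.Dual ℂ N, φ ∘ₗ i₁ = 0 → φ ∘ₗ i₂ = 0 → φ = 0)
    {S : Submodule ℂ (Module.Dual ℂ N)} {n : ℕ} (b : Module.Basis (Fin n) ℂ S) :
    ∃ (z : Fin n → N) (I : Finset (Fin n)), I.card = Module.finrank ℂ
        (S ⊓ LinearMap.ker i₁.dualMap : Submodule ℂ (Module.Dual ℂ N)) ∧
      (∀ k ∈ I, z k ∈ LinearMap.range i₂) ∧ (∀ k ∉ I, z k ∈ LinearMap.range i₁) ∧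
      (Matrix.of fun i k => (b i : Module.Dual ℂ N) (z k)).det ≠ 0 := by
  have : FiniteDimensional ℂ S := Module.Finite.of_basis b
  have hn : Module.finrank ℂ S = n := by rw [Module.finrank_eq_card_basis b, Fintype.card_fin]
  obtain ⟨x, y, hxy⟩ := exists_separating_vectors i₁ i₂ hi (S := S)
  have hle : Module.finrank ℂ (S ⊓ LinearMap.ker i₁.dualMap : Submodule ℂ (Module.Dual ℂ N)) ≤
      Module.finrank ℂ S := Submodule.finrank_mono inf_le_left
  generalize hd : Module.finrank ℂ
    (S ⊓ LinearMap.ker i₁.dualMap : Submodule ℂ (Module.Dual ℂ N)) = d at *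
  let σ : Fin (Module.finrank ℂ S - d) ⊕ Fin d ≃ Fin n :=
    Fintype.equivOfCardEq (by simp; omega)
  refine ⟨fun k => Sum.elim (fun i => i₁ (x i)) (fun i => i₂ (y i)) (σ.symm k),
    Finset.univ.map (Function.Embedding.inr.trans σ.toEmbedding), by simp, ?_, ?_, ?_⟩
  · intro k hk
    obtain ⟨i, -, rfl⟩ := Finset.mem_map.1 hk
    simp
  · intro k hk
    obtain ⟨i, rfl⟩ := σ.surjective k
    rcases i with i | i
    · simp
    · exact (hk (Finset.mem_map.2 ⟨i, Finset.mem_univ _, rfl⟩)).elim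
  · intro hdet
    -- A row dependency is an element of `S` killed by all the separating vectors, hence zero.
    obtain ⟨v, hv, hv0⟩ := Matrix.exists_vecMul_eq_zero_iff.2 hdet
    have hφ : ∀ w : N, (∑ i, v i • b i : S).1 w = ∑ i, v i * (b i : Module.Dual ℂ N) w := by
      intro w
      simp
    have h0 := hxy (∑ i, v i • b i : S).1 (Subtype.property _)
      (fun i => by
        have := congrFun hv0 (σ (Sum.inl i))
        rw [hφ]
        simpa [Matrix.vecMul, dotProduct] using this)
      (fun i => by
        have := congrFun hv0 (σ (Sum.inr i))
        rw [hφ]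
        simpa [Matrix.vecMul, dotProduct] using this)
    have h1 : ∑ i, v i • b i = 0 := Subtype.ext h0
    exact hv (funext fun i => Fintype.linearIndependent_iff.1 b.linearIndependent v h1 i)

variable {V : Type*} [AddCommGroup V] [Module ℂ V] {n : ℕ}

/-- The projection of `(V ⊕ ℂⁿ)*` onto `(ℂⁿ)*`. -/
def dualProjSnd (V : Type*) [AddCommGroup V] [Module ℂ V] (n : ℕ) :
    Module.Dual ℂ (V × (Fin n → ℂ)) →ₗ[ℂ] Module.Dual ℂ (V × (Fin n → ℂ)) :=
  (LinearMap.inr ℂ V (Fin n → ℂ) ∘ₗ LinearMap.snd ℂ V (Fin n → ℂ)).dualMap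

theorem dualProjSnd_apply_inl (φ : Module.Dual ℂ (V × (Fin n → ℂ))) (x : V) :
    dualProjSnd V n φ (x, 0) = 0 := map_zero φ

theorem dualProjSnd_apply_inr (φ : Module.Dual ℂ (V × (Fin n → ℂ))) (y : Fin n → ℂ) :
    dualProjSnd V n φ (0, y) = φ (0, y) := rfl

theorem dualProjSnd_idem (φ : Module.Dual ℂ (V × (Fin n → ℂ))) :
    dualProjSnd V n (dualProjSnd V n φ) = dualProjSnd V n φ := rfl

theorem dual_prod_eq_zero {W : Type*} [AddCommGroup W] [Module ℂ W] (φ : Module.Dual ℂ (V × W))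
    (h1 : φ ∘ₗ LinearMap.inl ℂ V W = 0) (h2 : φ ∘ₗ LinearMap.inr ℂ V W = 0) : φ = 0 :=
  LinearMap.prod_ext h1 h2

variable {S : Submodule ℂ (Module.Dual ℂ (V × (Fin n → ℂ)))}
  {β : ⋀[ℂ]^n (Module.Dual ℂ (V × (Fin n → ℂ)))}

/-- The dimension of the space of functionals in `S` that vanish on `V`. -/
def lowestWeight (S : Submodule ℂ (Module.Dual ℂ (V × (Fin n → ℂ)))) : ℕ :=
  Module.finrank ℂ (S ⊓ LinearMap.ker (LinearMap.inl ℂ V (Fin n → ℂ)).dualMap :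
    Submodule ℂ (Module.Dual ℂ (V × (Fin n → ℂ))))

/-- The codimension in `S` of the space of functionals that vanish on `ℂⁿ`. -/
def highestWeight (S : Submodule ℂ (Module.Dual ℂ (V × (Fin n → ℂ)))) : ℕ :=
  n - Module.finrank ℂ (S ⊓ LinearMap.ker (LinearMap.inr ℂ V (Fin n → ℂ)).dualMap :
    Submodule ℂ (Module.Dual ℂ (V × (Fin n → ℂ))))

/-- In a basis of `S` adapted to its functionals vanishing on `V`, those vectors always contribute
factors from `(ℂⁿ)*`; those vanishing on `ℂⁿ` never do. -/
theorem IsPlucker.le_of_weightProj_ne_zero (hβ : IsPlucker S β) {j : Fin (n + 1)}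
    (hj : weightProj n (dualProjSnd V n) j β ≠ 0) :
    lowestWeight S ≤ j ∧ (j : ℕ) ≤ highestWeight S := by
  obtain ⟨b, rfl⟩ := hβ
  constructor
  · by_contra! hlt
    refine hj (alternatingMap_eq_zero_of_adapted b
      (LinearMap.ker (LinearMap.inl ℂ V (Fin n → ℂ)).dualMap)
      ((weightProj n (dualProjSnd V n) j).compAlternatingMap (exteriorPower.ιMulti ℂ n))
      fun c I hI hc => ?_)
    refine weightProj_ιMulti_eq_zero_of_lt (I := I) (fun i hi => ?_) (by rwa [hI])
    refine LinearMap.prod_ext ?_ ?_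
    · ext x
      have := LinearMap.congr_fun (hc i hi) x
      simpa [dualProjSnd_apply_inl] using this.symm
    · ext x
      simp [dualProjSnd_apply_inr]
  · by_contra! hlt
    refine hj (alternatingMap_eq_zero_of_adapted b
      (LinearMap.ker (LinearMap.inr ℂ V (Fin n → ℂ)).dualMap)
      ((weightProj n (dualProjSnd V n) j).compAlternatingMap (exteriorPower.ιMulti ℂ n))
      fun c I hI hc => ?_)
    refine weightProj_ιMulti_eq_zero_of_gt (I := I) (fun i hi => ?_) (by rwa [hI])
    refine LinearMap.ext fun x => ?_
    exact LinearMap.congr_fun (hc i hi) x.2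

theorem IsPlucker.weightProj_lowest_ne_zero (hβ : IsPlucker S β) {j : Fin (n + 1)}
    (hj : (j : ℕ) = lowestWeight S) : weightProj n (dualProjSnd V n) j β ≠ 0 := by
  obtain ⟨b, rfl⟩ := hβ
  obtain ⟨z, I, hI, h2, h1, hdet⟩ := exists_det_ne_zero (LinearMap.inl ℂ V (Fin n → ℂ))
    (LinearMap.inr ℂ V (Fin n → ℂ)) dual_prod_eq_zero b
  refine weightProj_ne_zero_of_det (I := I) (fun φ k => ?_) hdet (hj.trans hI.symm)
  split_ifs with hk
  · obtain ⟨y, hy⟩ := h2 k hk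
    rw [← hy]
    simp [dualProjSnd_apply_inr]
  · obtain ⟨y, hy⟩ := h1 k hk
    rw [← hy]
    simp [dualProjSnd_apply_inl]

theorem IsPlucker.weightProj_highest_ne_zero (hβ : IsPlucker S β) {j : Fin (n + 1)}
    (hj : (j : ℕ) = highestWeight S) : weightProj n (dualProjSnd V n) j β ≠ 0 := by
  obtain ⟨b, rfl⟩ := hβ
  obtain ⟨z, I, hI, h2, h1, hdet⟩ := exists_det_ne_zero (LinearMap.inr ℂ V (Fin n → ℂ))
    (LinearMap.inl ℂ V (Fin n → ℂ)) (fun φ h h' => dual_prod_eq_zero φ h' h) b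
  refine weightProj_ne_zero_of_det (I := Iᶜ) (fun φ k => ?_) hdet
    (by rw [hj, Finset.card_compl, hI, Fintype.card_fin]; rfl)
  by_cases hk : k ∈ I
  · obtain ⟨y, hy⟩ := h2 k hk
    rw [← hy]
    simp [dualProjSnd_apply_inl, hk]
  · obtain ⟨y, hy⟩ := h1 k hk
    rw [← hy]
    simp [dualProjSnd_apply_inr, hk]

theorem exteriorPower_map_smul {M N : Type*} [AddCommGroup M] [Module ℂ M] [AddCommGroup N]
    [Module ℂ N] (n : ℕ) (c : ℂ) (f : M →ₗ[ℂ] N) :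
    exteriorPower.map n (c • f) = c ^ n • exteriorPower.map n f := by
  refine exteriorPower.linearMap_ext (AlternatingMap.ext fun b => ?_)
  simp only [LinearMap.compAlternatingMap_apply, exteriorPower.map_apply_ιMulti,
    LinearMap.smul_apply]
  have h := (exteriorPower.ιMulti ℂ n (M := N)).toMultilinearMap.map_smul_univ (fun _ => c) (f ∘ b)
  simp only [AlternatingMap.coe_multilinearMap, Finset.prod_const, Finset.card_univ,
    Fintype.card_fin] at h
  exact h

theorem unit_zpow_pow (t : ℂˣ) (n : ℕ) :
    ((t ^ (-(n : ℤ)) : ℂˣ) : ℂ) ^ n = ((t ^ (-((n * n : ℕ) : ℤ)) : ℂˣ) : ℂ) := by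
  rw [← Units.val_pow_eq_pow_val, ← zpow_natCast, ← zpow_mul]
  push_cast
  rw [neg_mul]

/-- The action on `ℙ(Hom(⋀ⁿ V, D)) × ℙ(⋀ⁿ (V ⊕ ℂⁿ)*)^ℓ` is a weight action. -/
theorem isWeightAction_cstar (V : Type*) [AddCommGroup V] [Module ℂ V] (D : Type*) [AddCommGroup D]
    [Module ℂ D] {n : ℕ} (hn : 0 < n) :
    GIT.IsWeightAction (cstarActP V n D) (cstarActQ V n) (n * n) (n + Module.finrank ℂ V)
      (weightProj n (dualProjSnd V n)) where
  pos := by omega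
  proj := weightProj_weightProj n dualProjSnd_idem
  actA t α := by
    have h : cstarActP V n D t α =
        α ∘ₗ exteriorPower.map n (((t ^ (-(n : ℤ)) : ℂˣ) : ℂ) • LinearMap.id) := rfl
    rw [h, exteriorPower_map_smul, unit_zpow_pow, exteriorPower.map_id, LinearMap.comp_smul,
      LinearMap.comp_id]
  actB t x := by
    have h4 : (preAct (D := ℂ) (cstarAct V n)) t = ((t ^ (-(n : ℤ)) : ℂˣ) : ℂ) •
        ((LinearMap.id - dualProjSnd V n) + ((t : ℂ) ^ (n + Module.finrank ℂ V)) •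
          dualProjSnd V n) := by
      refine LinearMap.ext fun φ => LinearMap.prod_ext ?_ ?_
      · ext x
        change φ (((t ^ (-(n : ℤ)) : ℂˣ) : ℂ) • x,
          ((t ^ (Module.finrank ℂ V) : ℂˣ) : ℂ) • (0 : Fin n → ℂ)) = _
        have : (((t ^ (-(n : ℤ)) : ℂˣ) : ℂ) • x,
          ((t ^ (Module.finrank ℂ V) : ℂˣ) : ℂ) • (0 : Fin n → ℂ)) =
            ((t ^ (-(n : ℤ)) : ℂˣ) : ℂ) • ((x, 0) : V × (Fin n → ℂ)) := by simp
        rw [this, map_smul]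
        simp [dualProjSnd_apply_inl]
      · refine LinearMap.ext fun x => ?_
        change φ (((t ^ (-(n : ℤ)) : ℂˣ) : ℂ) • (0 : V),
          ((t ^ (Module.finrank ℂ V) : ℂˣ) : ℂ) • x) = _
        have : (((t ^ (-(n : ℤ)) : ℂˣ) : ℂ) • (0 : V), ((t ^ (Module.finrank ℂ V) : ℂˣ) : ℂ) • x) =
            ((t ^ (Module.finrank ℂ V) : ℂˣ) : ℂ) • ((0, x) : V × (Fin n → ℂ)) := by simp
        rw [this, map_smul]
        simp [dualProjSnd_apply_inr, pow_add, ← mul_assoc]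
    change exteriorPower.map n ((preAct (D := ℂ) (cstarAct V n)) t) x = _
    rw [h4, exteriorPower_map_smul, unit_zpow_pow, LinearMap.smul_apply, map_scaling]
    simp only [pow_mul]

end Points

/-! ### The plane attached to a framing -/

section FramingPlane

variable {V W : Type*} [AddCommGroup V] [Module ℂ V] [AddCommGroup W] [Module ℂ W] {n : ℕ}

theorem prodMap_id_surjective {f : V →ₗ[ℂ] W} (hf : Function.Surjective f) :
    Function.Surjective (f.prodMap (LinearMap.id (M := Fin n → ℂ))) :=
  Function.Surjective.prodMap hf Function.surjective_id

/-- A functional annihilating a preimage kills `ker f`, so it descends uniquely along the surjection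
`f`. -/
theorem finrank_dualAnnihilator_comap {M N : Type*} [AddCommGroup M] [Module ℂ M] [AddCommGroup N]
    [Module ℂ N] {f : M →ₗ[ℂ] N} (hf : Function.Surjective f) (h : Submodule ℂ N) :
    Module.finrank ℂ (h.comap f).dualAnnihilator = Module.finrank ℂ h.dualAnnihilator := by
  have e : (h.comap f).dualAnnihilator = h.dualAnnihilator.map f.dualMap := by
    ext φ
    rw [Submodule.mem_map]
    constructor
    · intro hφ
      have hker : φ ∈ (LinearMap.ker f).dualAnnihilator :=
        Submodule.dualAnnihilator_anti (fun x hx => by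
          rw [Submodule.mem_comap, LinearMap.mem_ker.1 hx]
          exact h.zero_mem) hφ
      rw [← LinearMap.range_dualMap_eq_dualAnnihilator_ker] at hker
      obtain ⟨ψ, rfl⟩ := hker
      refine ⟨ψ, (Submodule.mem_dualAnnihilator _).2 fun w hw => ?_, rfl⟩
      obtain ⟨x, rfl⟩ := hf w
      exact (Submodule.mem_dualAnnihilator _).1 hφ x hw
    · rintro ⟨ψ, hψ, rfl⟩
      exact (Submodule.mem_dualAnnihilator _).2 fun x hx =>
        (Submodule.mem_dualAnnihilator _).1 hψ (f x) hx
  rw [e]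
  exact (Submodule.equivMapOfInjective _
    (LinearMap.dualMap_injective_of_surjective hf) _).finrank_eq.symm

/-- The intersection is the annihilator of the preimage of `h ⊔ range i'`. Because `h` and `range
i'` have complementary dimensions, the codimension of their sum is the dimension of their
intersection. -/
theorem finrank_dualAnnihilator_comap_inf_ker {M N U U' : Type*} [AddCommGroup M] [Module ℂ M]
    [AddCommGroup N] [Module ℂ N] [FiniteDimensional ℂ N] [AddCommGroup U] [Module ℂ U]
    [AddCommGroup U'] [Module ℂ U'] {f : M →ₗ[ℂ] N} (hf : Function.Surjective f)
    (h : Submodule ℂ N) (i : U →ₗ[ℂ] M) (i' : U' →ₗ[ℂ] N)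
    (hi : (LinearMap.range i).map f = LinearMap.range i')
    (hdim : Module.finrank ℂ h + Module.finrank ℂ (LinearMap.range i') = Module.finrank ℂ N) :
    Module.finrank ℂ ((h.comap f).dualAnnihilator ⊓ LinearMap.ker i.dualMap :
      Submodule ℂ (Module.Dual ℂ M)) =
      Module.finrank ℂ (h ⊓ LinearMap.range i' : Submodule ℂ N) := by
  have e : h.comap f ⊔ LinearMap.range i = (h ⊔ LinearMap.range i').comap f := by
    rw [← hi]
    conv_rhs => rw [← Submodule.map_comap_eq_of_surjective hf h, ← Submodule.map_sup,
      Submodule.comap_map_eq]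
    refine (sup_eq_left.2 (le_sup_of_le_left fun x hx => ?_)).symm
    rw [Submodule.mem_comap, LinearMap.mem_ker.1 hx]
    exact h.zero_mem
  rw [LinearMap.ker_dualMap_eq_dualAnnihilator_range, ← Submodule.dualAnnihilator_sup_eq, e,
    finrank_dualAnnihilator_comap hf]
  have h1 := Subspace.finrank_add_finrank_dualAnnihilator_eq (h ⊔ LinearMap.range i')
  have h2 := Submodule.finrank_sup_add_finrank_inf_eq h (LinearMap.range i')
  omega

/-- The numerical invariants of a plane are preserved by an injective linear map between spaces of
the same dimension. -/
theorem plane_numbers_map {W' : Type*} [AddCommGroup W'] [Module ℂ W'] [FiniteDimensional ℂ W]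
    [FiniteDimensional ℂ W'] (T : W →ₗ[ℂ] W') (hT : Function.Injective T)
    (hdim : Module.finrank ℂ W = Module.finrank ℂ W') (g : Submodule ℂ (W × (Fin n → ℂ))) :
    sNumber (g.map (T.prodMap LinearMap.id)) = sNumber g ∧
      tNumber (g.map (T.prodMap LinearMap.id)) = tNumber g ∧
      Module.finrank ℂ (g.map (T.prodMap LinearMap.id)) = Module.finrank ℂ g := by
  have hinj : Function.Injective (T.prodMap (LinearMap.id (M := Fin n → ℂ))) :=
    Function.Injective.prodMap hT Function.injective_id
  have hsurj := (LinearMap.injective_iff_surjective_of_finrank_eq_finrank hdim).1 hT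
  have hR₁ : (LinearMap.range (LinearMap.inl ℂ W (Fin n → ℂ))).map
      (T.prodMap LinearMap.id) = LinearMap.range (LinearMap.inl ℂ W' (Fin n → ℂ)) := by
    rw [← LinearMap.range_comp]
    apply le_antisymm
    · rintro _ ⟨x, rfl⟩
      exact ⟨T x, by simp⟩
    · rintro _ ⟨x, rfl⟩
      obtain ⟨y, rfl⟩ := hsurj x
      exact ⟨y, by simp⟩
  have hR₂ : (LinearMap.range (LinearMap.inr ℂ W (Fin n → ℂ))).map
      (T.prodMap LinearMap.id) = LinearMap.range (LinearMap.inr ℂ W' (Fin n → ℂ)) := by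
    rw [← LinearMap.range_comp]
    apply le_antisymm
    · rintro _ ⟨x, rfl⟩
      exact ⟨x, by simp⟩
    · rintro _ ⟨x, rfl⟩
      exact ⟨x, by simp⟩
  refine ⟨?_, ?_, (Submodule.equivMapOfInjective _ hinj g).finrank_eq.symm⟩
  · rw [sNumber, sNumber, ← hR₁, ← Submodule.map_inf _ hinj]
    exact (Submodule.equivMapOfInjective _ hinj _).finrank_eq.symm
  · rw [tNumber, tNumber, ← hR₂, ← Submodule.map_inf _ hinj]
    exact (Submodule.equivMapOfInjective _ hinj _).finrank_eq.symm

theorem tNumber_le [FiniteDimensional ℂ W] (g : Submodule ℂ (W × (Fin n → ℂ))) : tNumber g ≤ n := by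
  calc tNumber g ≤ Module.finrank ℂ (LinearMap.range (LinearMap.inr ℂ W (Fin n → ℂ))) :=
        Submodule.finrank_mono inf_le_right
    _ = n := by rw [LinearMap.finrank_range_of_inj LinearMap.inr_injective, Module.finrank_fin_fun]

end FramingPlane

/-! ### The numerical criterion for the point attached to a framed bundle. -/

section Criterion

variable {X : Type*} [TopologicalSpace X] [ChartedSpace ℂ X]
variable (F : Type*) [NormedAddCommGroup F] [NormedSpace ℂ F]
variable (E : X → Type*) [∀ x, AddCommGroup (E x)] [∀ x, Module ℂ (E x)]
  [TopologicalSpace (TotalSpace F E)] [∀ x, TopologicalSpace (E x)]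
  [FiberBundle F E] [VectorBundle ℂ F E] [ContMDiffVectorBundle ω F E 𝓘(ℂ, ℂ)]
variable {n ℓ : ℕ}

theorem lowestWeight_framingDual {x : X} (hfd : FiniteDimensional ℂ (E x))
    (hrank : Module.finrank ℂ (E x) = n) (hgen : Function.Surjective (evalAt F E x))
    {h : Submodule ℂ (E x × (Fin n → ℂ))} (hh : Module.finrank ℂ h = n) :
    lowestWeight (framingDual F E x h) = sNumber h := by
  refine finrank_dualAnnihilator_comap_inf_ker (prodMap_id_surjective hgen) h _ _ ?_ ?_
  · rw [← LinearMap.range_comp]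
    apply le_antisymm
    · rintro _ ⟨v, rfl⟩
      exact ⟨evalAt F E x v, by simp⟩
    · rintro _ ⟨w, rfl⟩
      obtain ⟨v, rfl⟩ := hgen w
      exact ⟨v, by simp⟩
  · rw [hh, LinearMap.finrank_range_of_inj LinearMap.inl_injective, Module.finrank_prod, hrank,
      Module.finrank_fin_fun]

theorem highestWeight_framingDual {x : X} (hfd : FiniteDimensional ℂ (E x))
    (hrank : Module.finrank ℂ (E x) = n) (hgen : Function.Surjective (evalAt F E x))
    {h : Submodule ℂ (E x × (Fin n → ℂ))} (hh : Module.finrank ℂ h = n) :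
    highestWeight (framingDual F E x h) = n - tNumber h := by
  refine congrArg (n - ·)
    (finrank_dualAnnihilator_comap_inf_ker (prodMap_id_surjective hgen) h _ _ ?_ ?_)
  · rw [← LinearMap.range_comp]
    apply le_antisymm
    · rintro _ ⟨v, rfl⟩
      exact ⟨v, by simp⟩
    · rintro _ ⟨w, rfl⟩
      exact ⟨w, by simp⟩
  · rw [hh, LinearMap.finrank_range_of_inj LinearMap.inr_injective, Module.finrank_prod, hrank,
      Module.finrank_fin_fun]

theorem exists_isPlucker_framingDual (hn : 0 < n) {x : X} (hfd : FiniteDimensional ℂ (E x))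
    (hrank : Module.finrank ℂ (E x) = n) (hgen : Function.Surjective (evalAt F E x))
    {h : Submodule ℂ (E x × (Fin n → ℂ))} (hh : Module.finrank ℂ h = n) :
    ∃ β : ⋀[ℂ]^n (Module.Dual ℂ (HolSections F E × (Fin n → ℂ))),
      IsPlucker (framingDual F E x h) β := by
  have hdim : Module.finrank ℂ (framingDual F E x h) = n := by
    rw [framingDual, finrank_dualAnnihilator_comap (prodMap_id_surjective hgen)]
    have := Subspace.finrank_add_finrank_dualAnnihilator_eq h
    rw [hh, Module.finrank_prod, hrank, Module.finrank_fin_fun] at this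
    omega
  have : FiniteDimensional ℂ (framingDual F E x h) :=
    FiniteDimensional.of_finrank_pos (by omega)
  exact ⟨_, Module.finBasisOfFinrankEq ℂ _ hdim, rfl⟩

variable [FiniteDimensional ℂ F]

/-- Sections lifting a basis of one fibre have nonzero wedge there. -/
theorem detMap_ne_zero (hn : 0 < n) {x : X} (hrank : Module.finrank ℂ (E x) = n)
    (hgen : Function.Surjective (evalAt F E x)) : detMap F E n ≠ 0 := by
  intro h0
  have : FiniteDimensional ℂ (E x) := FiniteDimensional.of_finrank_pos (by omega)
  let e := Module.finBasisOfFinrankEq ℂ (E x) hrank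
  choose v hv using fun i => hgen (e i)
  have h1 : (detMap F E n (exteriorPower.ιMulti ℂ n v)).1 x = 0 := by
    rw [h0]
    rfl
  have h2 : exteriorPower.ιMulti ℂ n e = 0 := by
    rw [← h1]
    change _ = exteriorPower.map n (evalAt F E x) (exteriorPower.ιMulti ℂ n v)
    rw [exteriorPower.map_apply_ιMulti]
    congr 1
    exact funext fun i => (hv i).symm
  have h3 := congrArg (exteriorPower.alternatingMapLinearEquiv e.det) h2
  rw [exteriorPower.alternatingMapLinearEquiv_apply_ιMulti, e.det_self, map_zero] at h3
  exact one_ne_zero h3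

/-- The bounds do not involve `β`, so the choice of Plücker vectors is immaterial; `cstar_criterion`
then handles the existential over `β`. -/
theorem cstar_criterion_of_isPlucker (hn : 0 < n) (hrank : ∀ x, Module.finrank ℂ (E x) = n)
    (hgen : ∀ x, Function.Surjective (evalAt F E x)) (x₀ : X) (P : Fin ℓ → X)
    (h : ∀ i, Submodule ℂ (E (P i) × (Fin n → ℂ))) (hh : ∀ i, Module.finrank ℂ (h i) = n)
    {a b : ℕ} (ha : 0 < a)
    {β : Fin ℓ → ⋀[ℂ]^n (Module.Dual ℂ (HolSections F E × (Fin n → ℂ)))}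
    (hβ : ∀ i, IsPlucker (framingDual F E (P i) (h i)) (β i)) :
    (GIT.IsSemistable (cstarActP (HolSections F E) n (WedgeSections F E n))
        (cstarActQ (HolSections F E) n) a b (detMap F E n) β ↔
      b * (n + Module.finrank ℂ (HolSections F E)) * ∑ i, sNumber (h i) ≤ n * n * (a + b * ℓ) ∧
      n * n * (a + b * ℓ) ≤
        b * (n + Module.finrank ℂ (HolSections F E)) * ∑ i, (n - tNumber (h i))) ∧
    (GIT.IsStable (cstarActP (HolSections F E) n (WedgeSections F E n))
        (cstarActQ (HolSections F E) n) a b (detMap F E n) β ↔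
      b * (n + Module.finrank ℂ (HolSections F E)) * ∑ i, sNumber (h i) < n * n * (a + b * ℓ) ∧
      n * n * (a + b * ℓ) <
        b * (n + Module.finrank ℂ (HolSections F E)) * ∑ i, (n - tNumber (h i))) := by
  have hfd : ∀ x, FiniteDimensional ℂ (E x) := fun x =>
    FiniteDimensional.of_finrank_pos (by rw [hrank]; exact hn)
  have hlow := fun i => lowestWeight_framingDual F E (hfd (P i)) (hrank _) (hgen _) (hh i)
  have hhigh := fun i => highestWeight_framingDual F E (hfd (P i)) (hrank _) (hgen _) (hh i)
  have hs : ∀ i, sNumber (h i) < n + 1 := fun i => Nat.lt_succ_of_le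
    ((Submodule.finrank_mono inf_le_left).trans (hh i).le)
  have ht : ∀ i, n - tNumber (h i) < n + 1 := fun i => by omega
  have H := isWeightAction_cstar (HolSections F E) (WedgeSections F E n) hn
  have hα := detMap_ne_zero F E hn (hrank x₀) (hgen x₀)
  have c1 := fun i => (hβ i).weightProj_lowest_ne_zero (j := ⟨sNumber (h i), hs i⟩) (hlow i).symm
  have c2 := fun i =>
    (hβ i).weightProj_highest_ne_zero (j := ⟨n - tNumber (h i), ht i⟩) (hhigh i).symm
  have c3 : ∀ i j, weightProj n (dualProjSnd (HolSections F E) n) j (β i) ≠ 0 →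
      (⟨sNumber (h i), hs i⟩ : Fin (n + 1)) ≤ j ∧ j ≤ ⟨n - tNumber (h i), ht i⟩ := fun i j hj => by
    have := (hβ i).le_of_weightProj_ne_zero hj
    rw [hlow, hhigh] at this
    exact this
  exact ⟨H.isSemistable_iff hα c1 c2 c3, H.isStable_iff ha hα c1 c2 c3⟩

/-- The numerical criterion for the `ℂ*`-(semi)stability of a framed bundle. -/
theorem cstar_criterion (hn : 0 < n) (hrank : ∀ x, Module.finrank ℂ (E x) = n)
    (hgen : ∀ x, Function.Surjective (evalAt F E x)) (x₀ : X) (P : Fin ℓ → X)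
    (h : ∀ i, Submodule ℂ (E (P i) × (Fin n → ℂ))) (hh : ∀ i, Module.finrank ℂ (h i) = n)
    {a b : ℕ} (ha : 0 < a) :
    (IsCStarSemistable F E P h a b ↔
      b * (n + Module.finrank ℂ (HolSections F E)) * ∑ i, sNumber (h i) ≤ n * n * (a + b * ℓ) ∧
      n * n * (a + b * ℓ) ≤
        b * (n + Module.finrank ℂ (HolSections F E)) * ∑ i, (n - tNumber (h i))) ∧
    (IsCStarStable F E P h a b ↔
      b * (n + Module.finrank ℂ (HolSections F E)) * ∑ i, sNumber (h i) < n * n * (a + b * ℓ) ∧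
      n * n * (a + b * ℓ) <
        b * (n + Module.finrank ℂ (HolSections F E)) * ∑ i, (n - tNumber (h i))) := by
  have hfd : ∀ x, FiniteDimensional ℂ (E x) := fun x =>
    FiniteDimensional.of_finrank_pos (by rw [hrank]; exact hn)
  choose β hβ using fun i =>
    exists_isPlucker_framingDual F E hn (hfd (P i)) (hrank _) (hgen _) (hh i)
  have crit := fun {β} hβ =>
    cstar_criterion_of_isPlucker F E hn hrank hgen x₀ P h hh (b := b) ha (β := β) hβ
  exact ⟨⟨fun ⟨_, hβ, hss⟩ => (crit hβ).1.1 hss, fun hc => ⟨β, hβ, (crit hβ).1.2 hc⟩⟩,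
    ⟨fun ⟨_, hβ, hss⟩ => (crit hβ).2.1 hss, fun hc => ⟨β, hβ, (crit hβ).2.2 hc⟩⟩⟩

end Criterion

/-! ### The twist of a framed bundle and the main theorem -/

section TwistFibre

variable {X : Type*} [TopologicalSpace X]

theorem finrank_fibre (F : Type*) [NormedAddCommGroup F] [NormedSpace ℂ F] (E : X → Type*)
    [∀ x, AddCommGroup (E x)] [∀ x, Module ℂ (E x)] [TopologicalSpace (TotalSpace F E)]
    [∀ x, TopologicalSpace (E x)] [FiberBundle F E] [VectorBundle ℂ F E] (x : X) :
    Module.finrank ℂ (E x) = Module.finrank ℂ F :=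
  ((trivializationAt F E x).continuousLinearEquivAt ℂ x
    (mem_baseSet_trivializationAt F E x)).toLinearEquiv.finrank_eq

theorem finrank_twist_model (n : ℕ) :
    Module.finrank ℂ ((ℂ →L[ℂ] ℂ) →L[ℂ] (Fin n → ℂ)) = n := by
  have e : ∀ (A B : Type) [NormedAddCommGroup A] [NormedSpace ℂ A] [NormedAddCommGroup B]
      [NormedSpace ℂ B] [FiniteDimensional ℂ A] [FiniteDimensional ℂ B],
      Module.finrank ℂ (A →L[ℂ] B) = Module.finrank ℂ A * Module.finrank ℂ B := by
    intro A B _ _ _ _ _ _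
    rw [← (LinearMap.toContinuousLinearMap (𝕜 := ℂ) (E := A) (F' := B)).finrank_eq,
      Module.finrank_linearMap]
  rw [e, e]
  simp

/-- A trivialization of `N` is a functional not vanishing at `u`, and evaluating `e ⊗ u` on it
recovers `e` up to a nonzero scalar. -/
theorem twistFibre_injective (E N : X → Type*) [∀ x, AddCommGroup (E x)] [∀ x, Module ℂ (E x)]
    [∀ x, TopologicalSpace (E x)] [∀ x, IsTopologicalAddGroup (E x)]
    [∀ x, ContinuousSMul ℂ (E x)] [∀ x, AddCommGroup (N x)] [∀ x, Module ℂ (N x)]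
    [TopologicalSpace (TotalSpace ℂ N)] [∀ x, TopologicalSpace (N x)]
    [∀ x, IsTopologicalAddGroup (N x)] [∀ x, ContinuousSMul ℂ (N x)] [FiberBundle ℂ N]
    [VectorBundle ℂ ℂ N] (x : X) {u : N x} (hu : u ≠ 0) :
    Function.Injective (twistFibre E N x u) := by
  let T := (trivializationAt ℂ N x).continuousLinearEquivAt ℂ x
    (mem_baseSet_trivializationAt ℂ N x)
  let φ : DualBundle N x := (T : N x →L[ℂ] ℂ)
  intro e e' he
  have h1 : T u • e = T u • e' := congrArg (fun f : Twist E N x => f φ) he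
  exact smul_right_injective _ (fun h => hu (T.map_eq_zero_iff.1 h)) h1

end TwistFibre

/-! ### Arithmetic of the stability parameters. -/

section Parameters

variable {n g ℓ : ℕ} {δ₀ : ℤ} {k : ℕ}

theorem param_pos (h1 : -(((ℓ : ℤ) * n - 1) / 2) ≤ δ₀) (h2 : δ₀ ≤ ((ℓ : ℤ) * n - 1) / 2)
    (hk : g + ℓ + 2 * n * ℓ ≤ k) :
    0 < n ∧ (0 : ℚ) < ℓ * n - 2 * δ₀ ∧ 0 < gammaParam n ℓ δ₀ ∧
      0 < (k : ℚ) - g + muParam n ℓ δ₀ := by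
  have hn : 0 < n := by
    -- Integer division rounds down, so for `n = 0` the bound is `(-1)/2 = -1` and the range `1 ≤ δ₀
    -- ≤ -1` is empty.
    rcases Nat.eq_zero_or_pos n with rfl | hn
    · simp at h1 h2; omega
    · exact hn
  have hZ : (1 : ℤ) ≤ ℓ * n - 2 * δ₀ := by omega
  have hZ' : (1 : ℤ) ≤ ℓ * n + 2 * δ₀ := by omega
  have hQ : (1 : ℚ) ≤ ℓ * n - 2 * δ₀ := by exact_mod_cast hZ
  have hQ' : (1 : ℚ) ≤ ℓ * n + 2 * δ₀ := by exact_mod_cast hZ'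
  have hn' : (0 : ℚ) < n := by exact_mod_cast hn
  have hγ : gammaParam n ℓ δ₀ ≤ 2 * n := by
    rw [gammaParam, div_le_iff₀ (by linarith)]
    nlinarith
  have hδ : -(ℓ : ℚ) ≤ δ₀ / n := by
    rw [le_div_iff₀ hn']
    have : (0 : ℚ) ≤ ℓ * n := by positivity
    linarith
  have hkQ : (g : ℚ) + ℓ + 2 * n * ℓ ≤ k := by exact_mod_cast hk
  refine ⟨hn, by linarith, div_pos (by positivity) (by linarith), ?_⟩
  have := mul_le_mul_of_nonneg_right hγ (Nat.cast_nonneg (α := ℚ) ℓ)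
  rw [muParam]
  linarith

/-- The numerical identity relating the weights of the action to the slope condition. -/
theorem weight_identity {a b p : ℕ} (hn : 0 < n) (hd : (0 : ℚ) < ℓ * n - 2 * δ₀)
    (hκ : 0 < (k : ℚ) - g + muParam n ℓ δ₀) (ha : 0 < a)
    (hab : (b : ℚ) / a = etaParam n ℓ g δ₀ k) (hp : (p : ℤ) = δ₀ + k * n + n * (1 - g)) :
    ((n * n * (a + b * ℓ) : ℕ) : ℚ) = b * (n + p) * (ℓ * n / 2 - δ₀) := by
  have hn' : (n : ℚ) ≠ 0 := by exact_mod_cast hn.ne'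
  have ha' : (a : ℚ) ≠ 0 := by exact_mod_cast ha.ne'
  have hp' : (p : ℚ) = δ₀ + k * n + n * (1 - g) := by exact_mod_cast hp
  rw [etaParam, div_eq_div_iff ha' hκ.ne'] at hab
  have hγ : gammaParam n ℓ δ₀ * (ℓ * n - 2 * δ₀) = 2 * n := div_mul_cancel₀ _ hd.ne'
  have hδ : (δ₀ : ℚ) / n * n = δ₀ := div_mul_cancel₀ _ hn'
  rw [muParam] at hab
  push_cast
  rw [hp']
  generalize (δ₀ : ℚ) / n = e at *
  generalize gammaParam n ℓ δ₀ = c at *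
  rw [← hδ] at *
  -- With `δ₀ = e·n`, one has `n + p = n(k - g + μ + γℓ)`; `hab` turns `b(n + p)` into `nγ(a + bℓ)`,
  -- and `hγ` removes `γ`.
  linear_combination (-(n : ℚ) ^ 2 * (ℓ - 2 * e) / 2) * hab - ((n : ℚ) * (a + b * ℓ) / 2) * hγ

/-- Divide by `b(n + p) > 0`. The upper bound turns into one on `∑ t i` because `∑ (n - t i) = ℓn -
∑ t i`, where `ht` makes the truncated subtraction exact. -/
theorem criterion_iff {a b p : ℕ} {s t : Fin ℓ → ℕ} (ht : ∀ i, t i ≤ n) (hb : 0 < b) (hn : 0 < n)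
    (h : ((n * n * (a + b * ℓ) : ℕ) : ℚ) = b * (n + p) * (ℓ * n / 2 - δ₀)) :
    ((b * (n + p) * ∑ i, s i ≤ n * n * (a + b * ℓ) ∧
        n * n * (a + b * ℓ) ≤ b * (n + p) * ∑ i, (n - t i)) ↔
      (∑ i, (s i : ℚ) ≤ ℓ * n / 2 - δ₀) ∧ (∑ i, (t i : ℚ) ≤ ℓ * n / 2 + δ₀)) ∧
    ((b * (n + p) * ∑ i, s i < n * n * (a + b * ℓ) ∧
        n * n * (a + b * ℓ) < b * (n + p) * ∑ i, (n - t i)) ↔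
      (∑ i, (s i : ℚ) < ℓ * n / 2 - δ₀) ∧ (∑ i, (t i : ℚ) < ℓ * n / 2 + δ₀)) := by
  have hpos : (0 : ℚ) < b * (n + p) := by positivity
  have e1 : ((b * (n + p) * ∑ i, s i : ℕ) : ℚ) = b * (n + p) * ∑ i, (s i : ℚ) := by push_cast; rfl
  have e2 : ((b * (n + p) * ∑ i, (n - t i) : ℕ) : ℚ) =
      b * (n + p) * (ℓ * n - ∑ i, (t i : ℚ)) := by
    push_cast
    simp [Nat.cast_sub (ht _)]
  simp only [← Nat.cast_le (α := ℚ), ← Nat.cast_lt (α := ℚ), h, e1, e2, mul_le_mul_iff_right₀ hpos,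
    mul_lt_mul_iff_right₀ hpos]
  constructor
  · exact and_congr_right fun _ => ⟨fun _ => by linarith, fun _ => by linarith⟩
  · exact and_congr_right fun _ => ⟨fun _ => by linarith, fun _ => by linarith⟩

end Parameters

end

/-- Here `E` has rank `n` and degree `δ₀`, `N` is a line bundle of degree `k`, and the point whose
stability is tested is the one attached to the twist `E(k) = E ⊗ N`, with the planes `gr i`
transported along `E_{P i} ≅ (E ⊗ N)_{P i}`. The hypotheses `hgen` and `hdim` say that `E(k)` is a
quotient of `H⁰(E(k)) ⊗ 𝒪` and `dim H⁰(E(k)) = δ₀ + kn + n(1 - g)`. -/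
theorem mainTheorem4 (n g ℓ : ℕ) :
    ∃ k₀ : ℕ, ∀ δ₀ : ℤ, -(((ℓ : ℤ) * n - 1) / 2) ≤ δ₀ → δ₀ ≤ ((ℓ : ℤ) * n - 1) / 2 →
    ∀ k : ℕ, k₀ ≤ k →
    0 < etaParam n ℓ g δ₀ k ∧
    ∀ (X : Type*) [TopologicalSpace X] [T2Space X] [CompactSpace X] [ConnectedSpace X]
      [ChartedSpace ℂ X] [IsManifold 𝓘(ℂ, ℂ) ω X]
      (_hg : genus X = g)
      (P : Fin ℓ → X) (_hP : Function.Injective P)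
      (E : X → Type*) [∀ x, AddCommGroup (E x)] [∀ x, Module ℂ (E x)]
      [TopologicalSpace (TotalSpace (Fin n → ℂ) E)] [∀ x, TopologicalSpace (E x)]
      [∀ x, IsTopologicalAddGroup (E x)] [∀ x, ContinuousSMul ℂ (E x)]
      [FiberBundle (Fin n → ℂ) E] [VectorBundle ℂ (Fin n → ℂ) E]
      [ContMDiffVectorBundle ω (Fin n → ℂ) E 𝓘(ℂ, ℂ)]
      (_hE : HasDegree (Fin n → ℂ) E δ₀)
      (gr : ∀ i, Submodule ℂ (E (P i) × (Fin n → ℂ)))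
      (_hgr : ∀ i, Module.finrank ℂ (gr i) = n)
      (N : X → Type*) [∀ x, AddCommGroup (N x)] [∀ x, Module ℂ (N x)]
      [TopologicalSpace (TotalSpace ℂ N)] [∀ x, TopologicalSpace (N x)]
      [∀ x, IsTopologicalAddGroup (N x)] [∀ x, ContinuousSMul ℂ (N x)]
      [FiberBundle ℂ N] [VectorBundle ℂ ℂ N] [ContMDiffVectorBundle ω ℂ N 𝓘(ℂ, ℂ)]
      (_hN : HasDegree ℂ N k)
      (u : ∀ i, N (P i)) (_hu : ∀ i, u i ≠ 0)
      (_hgen : ∀ (x : X) (e : Twist E N x),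
        ∃ v : HolSections ((ℂ →L[ℂ] ℂ) →L[ℂ] (Fin n → ℂ)) (Twist E N), v x = e)
      (_hdim : (Module.finrank ℂ
        (HolSections ((ℂ →L[ℂ] ℂ) →L[ℂ] (Fin n → ℂ)) (Twist E N)) : ℤ) =
          δ₀ + k * n + n * (1 - g))
      (a b : ℕ) (_ha : 0 < a) (_hb : 0 < b) (_hab : (b : ℚ) / a = etaParam n ℓ g δ₀ k),
      (IsCStarSemistable ((ℂ →L[ℂ] ℂ) →L[ℂ] (Fin n → ℂ)) (Twist E N) P
          (fun i => (gr i).map ((twistFibre E N (P i) (u i)).prodMap LinearMap.id)) a b ↔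
        (∑ i, (sNumber (gr i) : ℚ) ≤ ℓ * n / 2 - δ₀) ∧
        (∑ i, (tNumber (gr i) : ℚ) ≤ ℓ * n / 2 + δ₀)) ∧
      (IsCStarStable ((ℂ →L[ℂ] ℂ) →L[ℂ] (Fin n → ℂ)) (Twist E N) P
          (fun i => (gr i).map ((twistFibre E N (P i) (u i)).prodMap LinearMap.id)) a b ↔
        (∑ i, (sNumber (gr i) : ℚ) < ℓ * n / 2 - δ₀) ∧
        (∑ i, (tNumber (gr i) : ℚ) < ℓ * n / 2 + δ₀)) := by
  -- From `γ ≤ 2n` and `δ₀/n ≥ -ℓ` follows `μ ≥ 2 - ℓ - 2nℓ`, so this bound gives `k - g + μ ≥ 2`.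
  refine ⟨g + ℓ + 2 * n * ℓ, fun δ₀ h1 h2 k hk => ?_⟩
  obtain ⟨hn, hd, hγ, hκ⟩ := param_pos h1 h2 hk
  refine ⟨div_pos hγ hκ, ?_⟩
  intro X _ _ _ _ _ _ _ P _ E _ _ _ _ _ _ _ _ _ _ gr hgr N _ _ _ _ _ _ _ _ _ _ u hu hgen hdim
    a b ha hb hab
  obtain ⟨x₀⟩ : Nonempty X := inferInstance
  have hE : ∀ x, Module.finrank ℂ (E x) = n := fun x =>
    (finrank_fibre (Fin n → ℂ) E x).trans (Module.finrank_fin_fun ℂ)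
  have hrank : ∀ x, Module.finrank ℂ (Twist E N x) = n := fun x =>
    (finrank_fibre ((ℂ →L[ℂ] ℂ) →L[ℂ] (Fin n → ℂ)) (Twist E N) x).trans (finrank_twist_model n)
  have hfdE : ∀ x, FiniteDimensional ℂ (E x) := fun x =>
    FiniteDimensional.of_finrank_pos (by rw [hE]; exact hn)
  have hfd : ∀ x, FiniteDimensional ℂ (Twist E N x) := fun x =>
    FiniteDimensional.of_finrank_pos (by rw [hrank]; exact hn)
  have hnum := fun i => @plane_numbers_map (E (P i)) _ _ n (Twist E N (P i))
    ContinuousLinearMap.addCommGroup ContinuousLinearMap.module (hfdE _) (hfd _)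
    (twistFibre E N (P i) (u i)) (twistFibre_injective E N (P i) (hu i))
    ((hE _).trans (hrank _).symm) (gr i)
  have crit := cstar_criterion ((ℂ →L[ℂ] ℂ) →L[ℂ] (Fin n → ℂ)) (Twist E N) hn hrank hgen x₀ P
    (fun i => (gr i).map ((twistFibre E N (P i) (u i)).prodMap LinearMap.id))
    (fun i => (hnum i).2.2.trans (hgr i)) (b := b) ha
  simp only [fun i => (hnum i).1, fun i => (hnum i).2.1] at crit
  have num := criterion_iff (s := fun i => sNumber (gr i)) (t := fun i => tNumber (gr i))
    (fun i => tNumber_le (gr i)) hb hn (weight_identity hn hd hκ ha hab hdim)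
  exact ⟨crit.1.trans num.1, crit.2.trans num.2⟩
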